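/- Let $F_1=1$, $F_2=2$, $F_{n+1}=F_n+F_{n-1}$ be the Fibonacci numbers and $\varphi=(1+\sqrt5)/2$. A far-difference representation of an integer $N$ is a way of writing $N$ as a finite sum of terms $\pm F_i$ ($i\ge 1$) such that any two terms of the same sign differ in index by at least $4$ and any two terms of opposite sign differ in index by at least $3$. Put $S_n=\sum_{0\le i<n/4}F_{n-4i}=F_n+F_{n-4}+F_{n-8}+\cdots$ (positive indices only; $S_0=0$). Every integer has exactly one far-difference representation, and for every $n\ge1$ the integers in $(S_{n-1},S_n]$ are exactly those whose far-difference representation has $+F_n$ as its term of largest index. Choose $N$ uniformly at random among the integers in $(S_{n-1},S_n]$, and let $K_n$ and $L_n$ be the numbers of positive and of negative summands in the far-difference representation of $N$. Let $$\rho=-\frac{21-2\varphi}{29+2\varphi}.$$ Then, as $n\to\infty$, the standardized pair $$\left(\frac{K_n-\mathbb E K_n}{\sqrt{\operatorname{Var}K_n}},\ \frac{L_n-\mathbb E L_n}{\sqrt{\operatorname{Var}L_n}}\right)$$ converges in distribution to the bivariate normal distribution with mean $0$ and covariance matrix $\begin{pmatrix}1&\rho\\ \rho&1\end{pmatrix}$,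 and the correlation coefficient of $K_n$ and $L_n$ converges to $\rho$. Moreover $\rho<0$ and $\rho\approx-0.551058$ (correct to six decimals). -/

import Mathlib

open MeasureTheory ProbabilityTheory Filter Topology

noncomputable section

namespace FarDifference

/-- The Fibonacci numbers with the indexing `F 1 = 1, F 2 = 2, F 3 = 3, F 4 = 5, …` that is
customary for Zeckendorf-type decompositions. -/
def F (n : ℕ) : ℤ := (Nat.fib (n + 1) : ℤ)

/-- A finite signed collection of Fibonacci numbers: the term `+F i` occurs for each `i ∈ pos`,
and the term `-F j` occurs for each `j ∈ neg`. -/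
structure SignedRep where
  /-- Indices of the positive summands. -/
  pos : Finset ℕ
  /-- Indices of the negative summands. -/
  neg : Finset ℕ

/-- The integer represented by a signed collection. -/
def SignedRep.value (R : SignedRep) : ℤ := ∑ i ∈ R.pos, F i - ∑ j ∈ R.neg, F j

/-- The far-difference condition: all indices are at least `1`, two distinct terms of the same
sign differ in index by at least `4`, two terms of opposite sign by at least `3`. -/
structure SignedRep.IsFarDifference (R : SignedRep) : Prop where
  one_le_pos : ∀ i ∈ R.pos, 1 ≤ i
  one_le_neg : ∀ j ∈ R.neg, 1 ≤ j
  pos_gap : ∀ i ∈ R.pos, ∀ j ∈ R.pos, i < j → i + 4 ≤ j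
  neg_gap : ∀ i ∈ R.neg, ∀ j ∈ R.neg, i < j → i + 4 ≤ j
  mixed_gap : ∀ i ∈ R.pos, ∀ j ∈ R.neg, i + 3 ≤ j ∨ j + 3 ≤ i

/-- `R` is a far-difference representation of the integer `N`. -/
def IsFarDifferenceRepOf (R : SignedRep) (N : ℤ) : Prop := R.IsFarDifference ∧ R.value = N

open Classical in
/-- The far-difference representation of `N` (the theorem contains the assertion that every
integer has exactly one, so that the default value is never used). -/
def farDifferenceRep (N : ℤ) : SignedRep :=
  if h : ∃ R, IsFarDifferenceRepOf R N then h.choose else ⟨∅, ∅⟩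

/-- The number of positive summands in the far-difference representation of `N`. -/
def numPos (N : ℤ) : ℝ := ((farDifferenceRep N).pos.card : ℝ)

/-- The number of negative summands in the far-difference representation of `N`. -/
def numNeg (N : ℤ) : ℝ := ((farDifferenceRep N).neg.card : ℝ)

/-- `S n = F n + F (n - 4) + F (n - 8) + ⋯`, the sum being over positive indices. -/
def S : ℕ → ℤ
  | 0 => 0
  | 1 => F 1
  | 2 => F 2
  | 3 => F 3
  | n + 4 => F (n + 4) + S n

theorem S_lt_succ : ∀ n : ℕ, S n < S (n + 1)
  | 0 => by simp [S, F]
  | 1 => by simp [S, F, Nat.fib_add_two]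
  | 2 => by simp [S, F, Nat.fib_add_two]
  | 3 => by simp [S, F, Nat.fib_add_two]
  | n + 4 => by
    have h := S_lt_succ n
    have h2 : F (n + 4) ≤ F (n + 1 + 4) := by
      unfold F
      exact_mod_cast Nat.fib_mono (by omega)
    have e : S (n + 4 + 1) = F (n + 1 + 4) + S (n + 1) := rfl
    have e' : S (n + 4) = F (n + 4) + S n := rfl
    omega

/-- The uniform probability measure on the integers of the interval `(S n, S (n + 1)]`. -/
def unif (n : ℕ) : Measure ℤ := uniformOn (Set.Ioc (S n) (S (n + 1)))

instance instIsProbabilityMeasureUnif (n : ℕ) : IsProbabilityMeasure (unif n) :=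
  isProbabilityMeasure_uniformOn (Set.finite_Ioc _ _) (Set.nonempty_Ioc.2 (S_lt_succ n))

/-- The random variable `X` centred at its mean and divided by its standard deviation. -/
def standardize {Ω : Type*} [MeasurableSpace Ω] (X : Ω → ℝ) (μ : Measure Ω) (ω : Ω) : ℝ :=
  (X ω - ∫ x, X x ∂μ) / √(variance X μ)

/-- The (Pearson) correlation coefficient of `X` and `Y`. -/
def correlation {Ω : Type*} [MeasurableSpace Ω] (X Y : Ω → ℝ) (μ : Measure Ω) : ℝ :=
  covariance X Y μ / (√(variance X μ) * √(variance Y μ))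

end FarDifference

end

namespace FarDifference

/-! The combinatorial part rests on `F_add_four_eq`, i.e. F_{n+4} = S_{n+3} + S_{n+1} + 1. It makes
the value ranges belonging to different leading terms disjoint and leaves no gap between them;
peeling off the leading term then gives uniqueness (`value_injective`) and existence
(`exists_of_abs_le`). The same peeling, together with N ↦ -N exchanging the two counts, gives the
coupled linear recursion `gen_add_four` for G_n(x,y) = ∑ x^K y^L and G_n(y,x).

Put x = exp(αε), y = exp(βε) with ε = w/√n, and multiply G_m by z^m. An exact analysis would take z
to be the dominant singularity z(x,y), with a left null vector (u,1) of the characteristic matrix;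
these yield a conserved linear functional of four consecutive values. Here z and u are instead
explicit exponentials of quadratics in ε, correct up to O(ε³) (`defect₁_isBigO`, `defect₂_isBigO`).
Over about n steps the functional drifts by only O(n · n^{-3/2}), so no root z(x,y) is ever
constructed or differentiated.

For real w everything is positive, and the almost conserved functional bounds z^m G_m uniformly for
m ≤ n + 10. Complex w follows by comparison with Re w. At ε = 0 the recursion has characteristic
roots inside the unit disc apart from a simple root 1, so the bounded normalized sequences flatten
out and the functional determines their limit (`tendsto_diag_of_isNormalized`). The quadratic
exponent of z then becomes a Gaussian factor: E exp(w · `deviation`) → exp(σ²w²/2) with σ² =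
`asympVar α β`, for every complex w (`tendsto_integral_exp_deviation`).

Real w gives convergence of first and second moments, hence of variances and, by polarization, of
the correlation. Imaginary w gives characteristic functions of all linear combinations; moment
convergence allows the true mean and standard deviation to replace the asymptotic ones, and Lévy's
continuity theorem concludes. -/

/-! ### Identities and inequalities for the sums `S`. -/

theorem F_nonneg (n : ℕ) : 0 ≤ F n := by simp [F]

theorem F_add_two (n : ℕ) : F (n + 2) = F n + F (n + 1) := by
  simp only [F]
  exact_mod_cast Nat.fib_add_two (n := n + 1)

theorem S_add_four (n : ℕ) : S (n + 4) = F (n + 4) + S n := rfl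

theorem S_strictMono : StrictMono S := strictMono_nat_of_lt_succ S_lt_succ

theorem S_nonneg (n : ℕ) : 0 ≤ S n := S_strictMono.monotone (Nat.zero_le n)

theorem le_S (n : ℕ) : (n : ℤ) ≤ S n := by
  induction n with
  | zero => simp [S]
  | succ n ih => have := S_lt_succ n; push_cast; omega

theorem F_add_four_eq : ∀ n : ℕ, F (n + 4) = S (n + 3) + S (n + 1) + 1
  | 0 => by simp [S, F, Nat.fib_add_two]
  | 1 => by simp [S, F, Nat.fib_add_two]
  | 2 => by simp [S, F, Nat.fib_add_two]
  | 3 => by simp [S, F, Nat.fib_add_two]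
  | n + 4 => by
    have h := F_add_four_eq n
    have h1 : S (n + 4 + 3) = F (n + 7) + S (n + 3) := rfl
    have h2 : S (n + 4 + 1) = F (n + 5) + S (n + 1) := rfl
    have h3 : F (n + 4 + 4) = F (n + 6) + F (n + 7) := F_add_two (n + 6)
    have h4 : F (n + 6) = F (n + 4) + F (n + 5) := F_add_two (n + 4)
    omega

/-- A representation led by `+F (n + 1)` has negative indices at most `n - 2`, so the right side
bounds its value from below. For `n < 2` the truncated index is harmless because `S 0 = 0`. -/
theorem S_lt_F_succ_sub (n : ℕ) : S n < F (n + 1) - S (n - 2) := by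
  match n with
  | 0 => simp [S, F]
  | 1 => simp [S, F, Nat.fib_add_two]
  | 2 => simp [S, F, Nat.fib_add_two]
  | n + 3 =>
    have h : F (n + 3 + 1) = S (n + 3) + S (n + 1) + 1 := F_add_four_eq n
    have e : n + 3 - 2 = n + 1 := by omega
    rw [e]
    omega

theorem F_succ_add_S_sub (n : ℕ) : F (n + 1) + S (n - 3) = S (n + 1) := by
  match n with
  | 0 => simp [S]
  | 1 => simp [S]
  | 2 => simp [S]
  | n + 3 => simp [S]

/-- The densest admissible choice is greedy: once `n` is used, everything else lies at or below `n -
4`. -/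
theorem sum_F_le_S (n : ℕ) : ∀ T : Finset ℕ, (∀ i ∈ T, 1 ≤ i) → (∀ i ∈ T, i ≤ n) →
    (∀ i ∈ T, ∀ j ∈ T, i < j → i + 4 ≤ j) → ∑ i ∈ T, F i ≤ S n := by
  induction n using Nat.strong_induction_on with
  | _ n ih =>
    intro T h1 hn hgap
    rcases Nat.eq_zero_or_pos n with rfl | hpos
    · have : T = ∅ := Finset.eq_empty_of_forall_notMem fun i hi ↦ by
        have := h1 i hi; have := hn i hi; omega
      simp [this, S]
    · by_cases hmem : n ∈ T
      · rw [← Finset.add_sum_erase T F hmem]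
        have key := ih (n - 4) (by omega) (T.erase n)
          (fun i hi ↦ h1 i (Finset.mem_of_mem_erase hi))
          (fun i hi ↦ by
            have hi' := Finset.mem_of_mem_erase hi
            have := hgap i hi' n hmem (lt_of_le_of_ne (hn i hi') (Finset.ne_of_mem_erase hi))
            omega)
          (fun i hi j hj ↦ hgap i (Finset.mem_of_mem_erase hi) j (Finset.mem_of_mem_erase hj))
        have h2 := F_succ_add_S_sub (n - 1)
        rw [show n - 1 + 1 = n by omega, show n - 1 - 3 = n - 4 by omega] at h2
        omega
      · have key := ih (n - 1) (by omega) T h1 (fun i hi ↦ by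
          have := hn i hi
          have : i ≠ n := fun h ↦ hmem (h ▸ hi)
          omega) hgap
        exact key.trans (S_strictMono.monotone (Nat.sub_le n 1))

/-! ### Existence and uniqueness of far-difference representations. -/

namespace SignedRep

/-- The collection with all signs reversed. -/
def swap (R : SignedRep) : SignedRep := ⟨R.neg, R.pos⟩

theorem value_swap (R : SignedRep) : R.swap.value = -R.value := by
  simp [swap, value]

theorem IsFarDifference.swap {R : SignedRep} (h : R.IsFarDifference) : R.swap.IsFarDifference where
  one_le_pos := h.one_le_neg
  one_le_neg := h.one_le_pos
  pos_gap := h.neg_gap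
  neg_gap := h.pos_gap
  mixed_gap i hi j hj := (h.mixed_gap j hj i hi).symm

/-- All indices occurring in `R` are at most `n`. -/
def IndexLE (R : SignedRep) (n : ℕ) : Prop := (∀ i ∈ R.pos, i ≤ n) ∧ ∀ j ∈ R.neg, j ≤ n

theorem IndexLE.swap {R : SignedRep} {n : ℕ} (h : R.IndexLE n) : R.swap.IndexLE n := ⟨h.2, h.1⟩

theorem IsFarDifference.value_le {R : SignedRep} (h : R.IsFarDifference) {n : ℕ}
    (hn : ∀ i ∈ R.pos, i ≤ n) : R.value ≤ S n := by
  have h1 := sum_F_le_S n R.pos h.one_le_pos hn h.pos_gap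
  have h2 : 0 ≤ ∑ j ∈ R.neg, F j := Finset.sum_nonneg fun j _ ↦ F_nonneg j
  simp only [value]
  omega

theorem IsFarDifference.neg_S_le_value {R : SignedRep} (h : R.IsFarDifference) {n : ℕ}
    (hn : ∀ j ∈ R.neg, j ≤ n) : -S n ≤ R.value := by
  have := h.swap.value_le hn
  rw [value_swap] at this
  omega

/-- The collection with the positive term of index `n` removed. -/
def erasePos (R : SignedRep) (n : ℕ) : SignedRep := ⟨R.pos.erase n, R.neg⟩

theorem IsFarDifference.erasePos {R : SignedRep} (h : R.IsFarDifference) (n : ℕ) :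
    (R.erasePos n).IsFarDifference where
  one_le_pos i hi := h.one_le_pos i (Finset.mem_of_mem_erase hi)
  one_le_neg := h.one_le_neg
  pos_gap i hi j hj := h.pos_gap i (Finset.mem_of_mem_erase hi) j (Finset.mem_of_mem_erase hj)
  neg_gap := h.neg_gap
  mixed_gap i hi := h.mixed_gap i (Finset.mem_of_mem_erase hi)

theorem value_erasePos {R : SignedRep} {n : ℕ} (h : n ∈ R.pos) :
    (R.erasePos n).value = R.value - F n := by
  simp only [value, erasePos, ← Finset.add_sum_erase R.pos F h]
  ring

theorem IsFarDifference.value_mem_Ioc {R : SignedRep} (h : R.IsFarDifference) {n : ℕ}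
    (hmem : n + 1 ∈ R.pos) (hn : R.IndexLE (n + 1)) : R.value ∈ Set.Ioc (S n) (S (n + 1)) := by
  refine ⟨?_, h.value_le hn.1⟩
  have h1 : -S (n - 2) ≤ (R.erasePos (n + 1)).value := by
    refine (h.erasePos _).neg_S_le_value fun j hj ↦ ?_
    have hj' : j ∈ R.neg := hj
    have := h.mixed_gap _ hmem j hj'
    have := hn.2 j hj'
    omega
  rw [value_erasePos hmem] at h1
  have := S_lt_F_succ_sub n
  omega

theorem IsFarDifference.value_lt_neg {R : SignedRep} (h : R.IsFarDifference) {n : ℕ}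
    (hmem : n + 1 ∈ R.neg) (hn : R.IndexLE (n + 1)) : R.value < -S n := by
  have := (h.swap.value_mem_Ioc (n := n) hmem hn.swap).1
  rw [value_swap] at this
  omega

theorem IndexLE.of_notMem {R : SignedRep} {n : ℕ} (h : R.IndexLE (n + 1)) (hp : n + 1 ∉ R.pos)
    (hq : n + 1 ∉ R.neg) : R.IndexLE n :=
  ⟨fun i hi ↦ Nat.le_of_lt_succ (lt_of_le_of_ne (h.1 i hi) (ne_of_mem_of_not_mem hi hp)),
    fun i hi ↦ Nat.le_of_lt_succ (lt_of_le_of_ne (h.2 i hi) (ne_of_mem_of_not_mem hi hq))⟩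

/-- The value alone detects the leading term: without `+F (n + 1)` on top, the value is either
negative or at most `S n`. This drives the uniqueness induction. -/
theorem IsFarDifference.mem_pos_iff {R : SignedRep} (h : R.IsFarDifference) {n : ℕ}
    (hn : R.IndexLE (n + 1)) : n + 1 ∈ R.pos ↔ S n < R.value := by
  refine ⟨fun hm ↦ (h.value_mem_Ioc hm hn).1, fun hv ↦ ?_⟩
  by_contra hp
  by_cases hq : n + 1 ∈ R.neg
  · have := h.value_lt_neg hq hn
    have := S_nonneg n
    omega
  · have := h.value_le (hn.of_notMem hp hq).1
    omega

theorem IsFarDifference.mem_neg_iff {R : SignedRep} (h : R.IsFarDifference) {n : ℕ}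
    (hn : R.IndexLE (n + 1)) : n + 1 ∈ R.neg ↔ R.value < -S n := by
  have := h.swap.mem_pos_iff hn.swap
  rw [value_swap] at this
  exact this.trans ⟨fun h ↦ by omega, fun h ↦ by omega⟩

theorem IsFarDifference.indexLE_erasePos {R : SignedRep} (h : R.IsFarDifference) {n : ℕ}
    (hmem : n + 1 ∈ R.pos) (hn : R.IndexLE (n + 1)) : (R.erasePos (n + 1)).IndexLE n := by
  refine ⟨fun i hi ↦ ?_, fun j hj ↦ ?_⟩
  · exact Nat.le_of_lt_succ
      (lt_of_le_of_ne (hn.1 i (Finset.mem_of_mem_erase hi)) (Finset.ne_of_mem_erase hi))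
  · have hj' : j ∈ R.neg := hj
    have := h.mixed_gap _ hmem j hj'
    have := hn.2 j hj'
    omega

theorem eq_of_erasePos_eq {R R' : SignedRep} {n : ℕ} (h : n ∈ R.pos) (h' : n ∈ R'.pos)
    (e : R.erasePos n = R'.erasePos n) : R = R' := by
  obtain ⟨p, q⟩ := R
  obtain ⟨p', q'⟩ := R'
  simp only [erasePos, mk.injEq] at e h h' ⊢
  exact ⟨by rw [← Finset.insert_erase h, ← Finset.insert_erase h', e.1], e.2⟩

theorem IsFarDifference.eq_of_value_eq (n : ℕ) : ∀ {R R' : SignedRep}, R.IsFarDifference →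
    R'.IsFarDifference → R.IndexLE n → R'.IndexLE n → R.value = R'.value → R = R' := by
  induction n with
  | zero =>
    have aux : ∀ R : SignedRep, R.IsFarDifference → R.IndexLE 0 → R = ⟨∅, ∅⟩ := by
      rintro ⟨p, q⟩ h hn
      congr
      · exact Finset.eq_empty_of_forall_notMem fun i hi ↦ by
          have := h.one_le_pos i hi; have := hn.1 i hi; omega
      · exact Finset.eq_empty_of_forall_notMem fun i hi ↦ by
          have := h.one_le_neg i hi; have := hn.2 i hi; omega
    intro R R' h h' hn hn' _
    rw [aux R h hn, aux R' h' hn']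
  | succ n ih =>
    have aux : ∀ R R' : SignedRep, R.IsFarDifference → R'.IsFarDifference → R.IndexLE (n + 1) →
        R'.IndexLE (n + 1) → R.value = R'.value → n + 1 ∈ R.pos → R = R' := by
      intro R R' h h' hn hn' hv hp
      have hp' : n + 1 ∈ R'.pos := by rwa [h'.mem_pos_iff hn', ← hv, ← h.mem_pos_iff hn]
      exact eq_of_erasePos_eq hp hp' (ih (h.erasePos _) (h'.erasePos _)
        (h.indexLE_erasePos hp hn) (h'.indexLE_erasePos hp' hn')
        (by rw [value_erasePos hp, value_erasePos hp', hv]))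
    intro R R' h h' hn hn' hv
    by_cases hp : n + 1 ∈ R.pos
    · exact aux R R' h h' hn hn' hv hp
    by_cases hq : n + 1 ∈ R.neg
    · have := aux R.swap R'.swap h.swap h'.swap hn.swap hn'.swap
        (by rw [value_swap, value_swap, hv]) hq
      exact congrArg SignedRep.swap this
    · have hp' : n + 1 ∉ R'.pos := by rwa [h'.mem_pos_iff hn', ← hv, ← h.mem_pos_iff hn]
      have hq' : n + 1 ∉ R'.neg := by rwa [h'.mem_neg_iff hn', ← hv, ← h.mem_neg_iff hn]
      exact ih h h' (hn.of_notMem hp hq) (hn'.of_notMem hp' hq') hv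

theorem exists_indexLE (R : SignedRep) : ∃ n, R.IndexLE n :=
  ⟨max (R.pos.sup id) (R.neg.sup id),
    fun _ hi ↦ (Finset.le_sup (f := id) hi).trans (le_max_left _ _),
    fun _ hi ↦ (Finset.le_sup (f := id) hi).trans (le_max_right _ _)⟩

theorem IndexLE.mono {R : SignedRep} {m n : ℕ} (h : R.IndexLE m) (hmn : m ≤ n) : R.IndexLE n :=
  ⟨fun i hi ↦ (h.1 i hi).trans hmn, fun i hi ↦ (h.2 i hi).trans hmn⟩

theorem IsFarDifference.value_injective {R R' : SignedRep} (h : R.IsFarDifference)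
    (h' : R'.IsFarDifference) (hv : R.value = R'.value) : R = R' := by
  obtain ⟨n, hn⟩ := R.exists_indexLE
  obtain ⟨n', hn'⟩ := R'.exists_indexLE
  exact eq_of_value_eq (max n n') h h' (hn.mono (le_max_left _ _)) (hn'.mono (le_max_right _ _)) hv

/-- The collection with a positive term of index `n` added. -/
def insertPos (R : SignedRep) (n : ℕ) : SignedRep := ⟨insert n R.pos, R.neg⟩

theorem value_insertPos {R : SignedRep} {n : ℕ} (h : n ∉ R.pos) :
    (R.insertPos n).value = R.value + F n := by
  simp only [value, insertPos, Finset.sum_insert h]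
  ring

theorem IsFarDifference.insertPos {R : SignedRep} (h : R.IsFarDifference) {n : ℕ} (hn : 1 ≤ n)
    (hp : ∀ i ∈ R.pos, i + 4 ≤ n) (hq : ∀ j ∈ R.neg, j + 3 ≤ n) :
    (R.insertPos n).IsFarDifference where
  one_le_pos i hi := by
    rcases Finset.mem_insert.1 hi with rfl | hi
    exacts [hn, h.one_le_pos i hi]
  one_le_neg := h.one_le_neg
  pos_gap i hi j hj hij := by
    rcases Finset.mem_insert.1 hi with hi | hi <;> rcases Finset.mem_insert.1 hj with hj | hj
    · omega
    · have := hp j hj; omega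
    · rw [hj]; exact hp i hi
    · exact h.pos_gap i hi j hj hij
  neg_gap := h.neg_gap
  mixed_gap i hi j hj := by
    rcases Finset.mem_insert.1 hi with rfl | hi
    exacts [.inr (hq j hj), h.mixed_gap i hi j hj]

theorem exists_of_abs_le (n : ℕ) : ∀ N : ℤ, -S n ≤ N → N ≤ S n →
    ∃ R : SignedRep, R.IsFarDifference ∧ R.IndexLE n ∧ R.value = N := by
  have h0 : (⟨∅, ∅⟩ : SignedRep).IsFarDifference := by constructor <;> simp
  induction n using Nat.strong_induction_on with
  | _ n ih =>
    have pos : ∀ N : ℤ, 0 ≤ N → N ≤ S n →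
        ∃ R : SignedRep, R.IsFarDifference ∧ R.IndexLE n ∧ R.value = N := by
      intro N hN0 hN
      match n with
      | 0 => exact ⟨⟨∅, ∅⟩, h0, by simp [IndexLE], by simp [value, S] at hN ⊢; omega⟩
      | n + 1 =>
        rcases le_or_gt N (S n) with hle | hgt
        · have := S_nonneg n
          obtain ⟨R, h, hR, hv⟩ := ih n (by omega) N (by omega) hle
          exact ⟨R, h, hR.mono (by omega), hv⟩
        -- For `n < 3` the interval contains the single integer `F (n + 1)`.
        · have small : N - F (n + 1) = 0 ∧ n < 3 ∨ 3 ≤ n := by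
            match n with
            | 0 => simp [S, F] at hN hgt ⊢; omega
            | 1 => simp [S, F, Nat.fib_add_two] at hN hgt ⊢; omega
            | 2 => simp [S, F, Nat.fib_add_two] at hN hgt ⊢; omega
            | n + 3 => right; omega
          rcases small with ⟨hz, -⟩ | h3
          · refine ⟨insertPos ⟨∅, ∅⟩ (n + 1), h0.insertPos (by omega) (by simp) (by simp),
              by simp [IndexLE, insertPos], ?_⟩
            rw [value_insertPos (by simp)]
            simp only [value, Finset.sum_empty]
            omega
          · obtain ⟨k, rfl⟩ := Nat.exists_eq_add_of_le' h3
            have e1 := F_add_four_eq k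
            have e2 := S_add_four k
            have e3 := S_lt_succ k
            have e4 : S (k + 3 + 1) = S (k + 4) := rfl
            obtain ⟨R, h, hR, hv⟩ := ih (k + 1) (by omega) (N - F (k + 4))
              (by omega) (by omega)
            -- The remainder lies in the asymmetric window `[-S (k + 1), S k]`. Its upper end rules
            -- out a positive term of index `k + 1`, leaving gap 4 to `k + 4` for positive terms and
            -- gap 3 for negative ones.
            have hk : ∀ i ∈ R.pos, i ≤ k := fun i hi ↦ by
              have h1 := hR.1 i hi
              have h2 : i ≠ k + 1 := by
                rintro rfl
                have := (h.mem_pos_iff hR).1 hi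
                omega
              omega
            refine ⟨R.insertPos (k + 4), h.insertPos (by omega) (fun i hi ↦ ?_) (fun j hj ↦ ?_),
              ⟨fun i hi ↦ ?_, fun j hj ↦ ?_⟩, ?_⟩
            · have := hk i hi; omega
            · have := hR.2 j hj; omega
            · rcases Finset.mem_insert.1 hi with rfl | hi
              · omega
              · have := hk i hi; omega
            · have := hR.2 j hj; omega
            · rw [value_insertPos (fun hm ↦ by have := hk _ hm; omega)]
              omega
    intro N h1 h2
    rcases le_total 0 N with hN | hN
    · exact pos N hN h2
    · obtain ⟨R, h, hR, hv⟩ := pos (-N) (by omega) (by omega)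
      exact ⟨R.swap, h.swap, hR.swap, by rw [value_swap]; omega⟩

end SignedRep

open SignedRep

theorem existsUnique_rep (N : ℤ) : ∃! R : SignedRep, IsFarDifferenceRepOf R N := by
  have h1 := le_S N.natAbs
  obtain ⟨R, h, -, hv⟩ := exists_of_abs_le N.natAbs N (by omega) (by omega)
  exact ⟨R, ⟨h, hv⟩, fun R' h' ↦ h'.1.value_injective h (h'.2.trans hv.symm)⟩

theorem farDifferenceRep_spec (N : ℤ) : IsFarDifferenceRepOf (farDifferenceRep N) N := by
  have h := (existsUnique_rep N).exists
  rw [farDifferenceRep, dif_pos h]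
  exact h.choose_spec

theorem farDifferenceRep_eq {R : SignedRep} {N : ℤ} (h : IsFarDifferenceRepOf R N) :
    farDifferenceRep N = R :=
  (existsUnique_rep N).unique (farDifferenceRep_spec N) h

theorem indexLE_farDifferenceRep {N : ℤ} {n : ℕ} (h1 : -S n ≤ N) (h2 : N ≤ S n) :
    (farDifferenceRep N).IndexLE n := by
  obtain ⟨R, h, hn, hv⟩ := exists_of_abs_le n N h1 h2
  rwa [farDifferenceRep_eq ⟨h, hv⟩]

theorem mem_pos_farDifferenceRep {N : ℤ} {n : ℕ} (h : N ∈ Set.Ioc (S n) (S (n + 1))) :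
    n + 1 ∈ (farDifferenceRep N).pos ∧ (farDifferenceRep N).IndexLE (n + 1) := by
  have h0 := S_nonneg n
  have h3 := h.1
  have h4 := h.2
  have hn : (farDifferenceRep N).IndexLE (n + 1) := indexLE_farDifferenceRep (by omega) h.2
  refine ⟨?_, hn⟩
  rw [(farDifferenceRep_spec N).1.mem_pos_iff hn, (farDifferenceRep_spec N).2]
  exact h.1

theorem mem_Ioc_iff (n : ℕ) (N : ℤ) : N ∈ Set.Ioc (S n) (S (n + 1)) ↔
    n + 1 ∈ (farDifferenceRep N).pos ∧ (∀ i ∈ (farDifferenceRep N).pos, i ≤ n + 1) ∧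
      ∀ j ∈ (farDifferenceRep N).neg, j ≤ n + 1 := by
  refine ⟨mem_pos_farDifferenceRep, fun ⟨h1, h2⟩ ↦ ?_⟩
  have := (farDifferenceRep_spec N).1.value_mem_Ioc h1 h2
  rwa [(farDifferenceRep_spec N).2] at this

theorem farDifferenceRep_neg (N : ℤ) : farDifferenceRep (-N) = (farDifferenceRep N).swap :=
  farDifferenceRep_eq ⟨(farDifferenceRep_spec N).1.swap, by
    rw [value_swap, (farDifferenceRep_spec N).2]⟩

theorem farDifferenceRep_sub {N : ℤ} {n : ℕ} (h : N ∈ Set.Ioc (S n) (S (n + 1))) :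
    farDifferenceRep (N - F (n + 1)) = (farDifferenceRep N).erasePos (n + 1) :=
  farDifferenceRep_eq ⟨(farDifferenceRep_spec N).1.erasePos _, by
    rw [value_erasePos (mem_pos_farDifferenceRep h).1, (farDifferenceRep_spec N).2]⟩

/-! ### Recursion for the bivariate generating functions. -/

section GeneratingFunction

variable {R : Type*} [CommRing R]

/-- The monomial recording the numbers of positive and negative summands of `N`. -/
noncomputable def monomial (x y : R) (N : ℤ) : R :=
  x ^ (farDifferenceRep N).pos.card * y ^ (farDifferenceRep N).neg.card

/-- The generating function of the numbers of positive and negative summands over the integers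
with largest term `+F (n + 1)`. -/
noncomputable def gen (x y : R) (n : ℕ) : R := ∑ N ∈ Finset.Ioc (S n) (S (n + 1)), monomial x y N

theorem monomial_neg (x y : R) (N : ℤ) : monomial x y (-N) = monomial y x N := by
  simp only [monomial, farDifferenceRep_neg, SignedRep.swap]
  ring

theorem monomial_eq_mul (x y : R) {N : ℤ} {n : ℕ} (h : N ∈ Set.Ioc (S n) (S (n + 1))) :
    monomial x y N = x * monomial x y (N - F (n + 1)) := by
  have hm := (mem_pos_farDifferenceRep h).1
  simp only [monomial, farDifferenceRep_sub h, SignedRep.erasePos]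
  rw [← Finset.card_erase_add_one hm, pow_succ]
  ring

/-- Removing the leading term is the translation by `F (m + 4)`; by `F_add_four_eq` it carries the
interval exactly onto `[-S (m + 1), S m]`. -/
theorem gen_add_three (x y : R) (m : ℕ) :
    gen x y (m + 3) = x * ∑ N ∈ Finset.Icc (-S (m + 1)) (S m), monomial x y N := by
  rw [gen, Finset.mul_sum]
  have e1 := F_add_four_eq m
  have e2 := S_add_four m
  have e3 : S (m + 3 + 1) = S (m + 4) := rfl
  refine Finset.sum_bij (fun N _ ↦ N - F (m + 4)) ?_ ?_ ?_ ?_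
  · intro N hN
    simp only [Finset.mem_Ioc, Finset.mem_Icc] at hN ⊢
    omega
  · intro a _ b _ h
    simpa using h
  · intro N hN
    refine ⟨N + F (m + 4), ?_, by ring⟩
    simp only [Finset.mem_Ioc, Finset.mem_Icc] at hN ⊢
    omega
  · intro N hN
    exact monomial_eq_mul x y (by simpa using hN)

/-- Raising the index by one enlarges the window of `gen_add_three` by a positive block and a
negative block. Reflecting the negative block exchanges `x` and `y`, which couples the two
generating functions. -/
theorem gen_add_four (x y : R) (m : ℕ) :
    gen x y (m + 4) = gen x y (m + 3) + x * (gen x y m + gen y x (m + 1)) := by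
  have h1 := S_lt_succ m
  have h2 := S_lt_succ (m + 1)
  have h0 := S_nonneg m
  have hneg : gen y x (m + 1) = ∑ N ∈ Finset.Ico (-S (m + 2)) (-S (m + 1)), monomial x y N := by
    refine Finset.sum_bij (fun N _ ↦ -N) ?_ ?_ ?_ ?_
    · intro N hN
      simp only [Finset.mem_Ioc, Finset.mem_Ico] at hN ⊢
      have : m + 1 + 1 = m + 2 := rfl
      rw [this] at hN
      omega
    · intro a _ b _ h
      simpa using h
    · intro N hN
      refine ⟨-N, ?_, by ring⟩
      simp only [Finset.mem_Ioc, Finset.mem_Ico] at hN ⊢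
      have : m + 1 + 1 = m + 2 := rfl
      rw [this]
      omega
    · intro N _
      rw [monomial_neg]
  have e : Finset.Icc (-S (m + 2)) (S (m + 1)) =
      Finset.Icc (-S (m + 1)) (S m) ∪
        (Finset.Ioc (S m) (S (m + 1)) ∪ Finset.Ico (-S (m + 2)) (-S (m + 1))) := by
    ext N
    simp only [Finset.mem_union, Finset.mem_Icc, Finset.mem_Ioc, Finset.mem_Ico]
    have : m + 1 + 1 = m + 2 := rfl
    rw [this] at h2
    omega
  rw [gen_add_three, gen_add_three, ← mul_add, hneg, gen,
    show m + 1 + 1 = m + 2 from rfl, e,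
    Finset.sum_union, Finset.sum_union]
  · rw [Finset.disjoint_left]
    intro N hN hN'
    simp only [Finset.mem_Ioc, Finset.mem_Ico] at hN hN'
    omega
  · rw [Finset.disjoint_left]
    intro N hN hN'
    simp only [Finset.mem_union, Finset.mem_Icc, Finset.mem_Ioc, Finset.mem_Ico] at hN hN'
    omega

end GeneratingFunction

/-! ### The almost conserved functional and the bounds it gives. -/

/-- The recursion of a pair of generating functions, after multiplication by powers of `z`. -/
def IsNormalized {R : Type*} [CommRing R] (x y z : R) (a b : ℕ → R) : Prop :=
  ∀ m, a (m + 4) = z * a (m + 3) + x * z ^ 4 * a m + x * z ^ 3 * b (m + 1) ∧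
    b (m + 4) = z * b (m + 3) + y * z ^ 4 * b m + y * z ^ 3 * a (m + 1)

/-- The first component of the defect of `(u, 1)` as a left null vector. -/
def defect₁ {R : Type*} [CommRing R] (x y z u : R) : R := u * (1 - z - x * z ^ 4) - y * z ^ 3

/-- The second component of the defect of `(u, 1)` as a left null vector. -/
def defect₂ {R : Type*} [CommRing R] (x y z u : R) : R := 1 - z - y * z ^ 4 - x * u * z ^ 3

/-- A linear functional of four consecutive values, conserved when both defects vanish. -/
def potential {R : Type*} [CommRing R] (x y z u : R) (a b : ℕ → R) (m : ℕ) : R :=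
  u * z * a (m + 3) + y * z ^ 3 * (a (m + 3) + a (m + 2) + a (m + 1)) +
    u * x * z ^ 4 * (a (m + 3) + a (m + 2) + a (m + 1) + a m) +
  (z * b (m + 3) + x * u * z ^ 3 * (b (m + 3) + b (m + 2) + b (m + 1)) +
    y * z ^ 4 * (b (m + 3) + b (m + 2) + b (m + 1) + b m))

/-- Add `u` times the first recursion to the second. Each delayed term is the current value minus a
difference that telescopes into a sliding-window sum; the windows form the potential, and what
remains of the current values is multiplied by the defects. -/
theorem potential_succ {R : Type*} [CommRing R] {x y z : R} (u : R) {a b : ℕ → R}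
    (h : IsNormalized x y z a b) (m : ℕ) :
    potential x y z u a b (m + 1) = potential x y z u a b m -
      defect₁ x y z u * a (m + 4) - defect₂ x y z u * b (m + 4) := by
  obtain ⟨h1, h2⟩ := h m
  simp only [potential, defect₁, defect₂, show m + 1 + 3 = m + 4 by ring,
    show m + 1 + 2 = m + 3 by ring, show m + 1 + 1 = m + 2 by ring]
  linear_combination u * h1 + h2

/-- All coefficients are positive, and the two longest windows alone weight every entry by at least
1/10. The hypotheses hold near the limit point because τ⁴ ≈ 0.146. -/
theorem le_ten_mul_potential {x y z u : ℝ} (hx : 0 < x) (hy : 0 < y) (hz : 0 < z) (hu : 0 < u)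
    (h1 : 1 / 10 ≤ u * x * z ^ 4) (h2 : 1 / 10 ≤ y * z ^ 4) {a b : ℕ → ℝ} (ha : ∀ m, 0 ≤ a m)
    (hb : ∀ m, 0 ≤ b m) (m : ℕ) :
    a m + b m ≤ 10 * potential x y z u a b m ∧
      a (m + 3) + b (m + 3) ≤ 10 * potential x y z u a b m := by
  have key : 1 / 10 * (a (m + 3) + a (m + 2) + a (m + 1) + a m) +
      1 / 10 * (b (m + 3) + b (m + 2) + b (m + 1) + b m) ≤ potential x y z u a b m := by
    have e1 := mul_le_mul_of_nonneg_right h1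
      (show 0 ≤ a (m + 3) + a (m + 2) + a (m + 1) + a m by
        linarith [ha (m + 3), ha (m + 2), ha (m + 1), ha m])
    have e2 := mul_le_mul_of_nonneg_right h2
      (show 0 ≤ b (m + 3) + b (m + 2) + b (m + 1) + b m by
        linarith [hb (m + 3), hb (m + 2), hb (m + 1), hb m])
    have e3 : 0 ≤ u * z * a (m + 3) := by have := ha (m + 3); positivity
    have e4 : 0 ≤ z * b (m + 3) := by have := hb (m + 3); positivity
    have e5 : 0 ≤ y * z ^ 3 * (a (m + 3) + a (m + 2) + a (m + 1)) := by
      have := ha (m + 3); have := ha (m + 2); have := ha (m + 1); positivity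
    have e6 : 0 ≤ x * u * z ^ 3 * (b (m + 3) + b (m + 2) + b (m + 1)) := by
      have := hb (m + 3); have := hb (m + 2); have := hb (m + 1); positivity
    simp only [potential]
    linarith
  constructor <;>
    linarith [ha (m + 3), ha (m + 2), ha (m + 1), ha m, hb (m + 3), hb (m + 2), hb (m + 1), hb m]

/-- A discrete Grönwall argument: the one-step drift is at most `η` times the new entries, which the
new potential itself controls. -/
theorem potential_le {x y z u η : ℝ} (hx : 0 < x) (hy : 0 < y) (hz : 0 < z) (hu : 0 < u)
    (h1 : 1 / 10 ≤ u * x * z ^ 4) (h2 : 1 / 10 ≤ y * z ^ 4) {a b : ℕ → ℝ} (ha : ∀ m, 0 ≤ a m)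
    (hb : ∀ m, 0 ≤ b m) (h : IsNormalized x y z a b) (hd1 : |defect₁ x y z u| ≤ η)
    (hd2 : |defect₂ x y z u| ≤ η) (hη : 20 * η ≤ 1) (m : ℕ) :
    potential x y z u a b m ≤ Real.exp (20 * η * m) * potential x y z u a b 0 := by
  have hη0 : 0 ≤ η := (abs_nonneg _).trans hd1
  induction m with
  | zero => simp
  | succ m ih =>
    have hle := (le_ten_mul_potential hx hy hz hu h1 h2 ha hb (m + 1)).2
    rw [show m + 1 + 3 = m + 4 by ring] at hle
    have hs := potential_succ u h m
    have hpos : 0 ≤ potential x y z u a b (m + 1) := by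
      linarith [ha (m + 4), hb (m + 4)]
    have b1 : -(defect₁ x y z u * a (m + 4)) ≤ η * a (m + 4) := by
      rw [← neg_mul]
      exact mul_le_mul_of_nonneg_right ((neg_le_abs _).trans hd1) (ha _)
    have b2 : -(defect₂ x y z u * b (m + 4)) ≤ η * b (m + 4) := by
      rw [← neg_mul]
      exact mul_le_mul_of_nonneg_right ((neg_le_abs _).trans hd2) (hb _)
    have b3 := mul_le_mul_of_nonneg_left hle hη0
    have b4 : (1 - 10 * η) * potential x y z u a b (m + 1) ≤ potential x y z u a b m := by
      linarith
    -- The product is 1 + 10η(1 - 20η); this is where `20 * η ≤ 1` is needed.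
    have b5 : 1 ≤ (1 + 20 * η) * (1 - 10 * η) := by nlinarith
    have b6 : potential x y z u a b (m + 1) ≤ (1 + 20 * η) * potential x y z u a b m := by
      have := mul_le_mul_of_nonneg_left b4 (show 0 ≤ 1 + 20 * η by linarith)
      have := mul_le_mul_of_nonneg_right b5 hpos
      linarith
    have hpos' : 0 ≤ potential x y z u a b m := by
      have := (le_ten_mul_potential hx hy hz hu h1 h2 ha hb m).1
      linarith [ha m, hb m]
    calc potential x y z u a b (m + 1) ≤ (1 + 20 * η) * potential x y z u a b m := b6
      _ ≤ Real.exp (20 * η) * potential x y z u a b m := by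
        refine mul_le_mul_of_nonneg_right ?_ hpos'
        linarith [Real.add_one_le_exp (20 * η)]
      _ ≤ Real.exp (20 * η) * (Real.exp (20 * η * m) * potential x y z u a b 0) :=
        mul_le_mul_of_nonneg_left ih (Real.exp_pos _).le
      _ = Real.exp (20 * η * (m + 1 : ℕ)) * potential x y z u a b 0 := by
        rw [← mul_assoc, ← Real.exp_add]
        push_cast
        ring_nf

/-- The reciprocal of the golden ratio. -/
noncomputable def tau : ℝ := Real.goldenRatio⁻¹

theorem tau_pos : 0 < tau := inv_pos.2 Real.goldenRatio_pos

theorem tau_sq : tau ^ 2 = 1 - tau := by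
  have h : tau = -Real.goldenConj := Real.inv_goldenRatio
  rw [h, neg_sq, Real.goldenConj_sq]
  ring

theorem tau_lt : tau < 0.6181 := by
  nlinarith [tau_sq, tau_pos]

theorem tau_sq_complex : (tau : ℂ) ^ 2 = 1 - tau := by exact_mod_cast congrArg Complex.ofReal tau_sq

theorem norm_tau : ‖(tau : ℂ)‖ = tau := by
  rw [Complex.norm_real, Real.norm_of_nonneg tau_pos.le]

theorem exists_bound_of_isNormalized {x y z u η : ℕ → ℝ} {a b : ℕ → ℕ → ℝ} {c : ℝ}
    (hx0 : ∀ n, 0 < x n) (hy0 : ∀ n, 0 < y n) (hz0 : ∀ n, 0 < z n) (hu0 : ∀ n, 0 < u n)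
    (hx : Tendsto x atTop (𝓝 1)) (hy : Tendsto y atTop (𝓝 1)) (hz : Tendsto z atTop (𝓝 tau))
    (hu : Tendsto u atTop (𝓝 1)) (ha : ∀ n m, 0 ≤ a n m) (hb : ∀ n m, 0 ≤ b n m)
    (h : ∀ n, IsNormalized (x n) (y n) (z n) (a n) (b n))
    (hd1 : ∀ᶠ n in atTop, |defect₁ (x n) (y n) (z n) (u n)| ≤ η n)
    (hd2 : ∀ᶠ n in atTop, |defect₂ (x n) (y n) (z n) (u n)| ≤ η n)
    (hη : Tendsto (fun n : ℕ ↦ ((n : ℝ) + 10) * η n) atTop (𝓝 0))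
    (hc : Tendsto (fun n ↦ potential (x n) (y n) (z n) (u n) (a n) (b n) 0) atTop (𝓝 c)) :
    ∃ C, ∀ᶠ n in atTop, ∀ m ≤ n + 10, a n m ≤ C ∧ b n m ≤ C := by
  have t4 : 1 / 10 < 1 * 1 * tau ^ 4 := by
    have : tau ^ 4 = 2 - 3 * tau := by linear_combination (tau ^ 2 - tau + 2) * tau_sq
    have := tau_lt
    norm_num at *
    linarith
  have e1 := ((hu.mul hx).mul (hz.pow 4)).eventually_const_le t4
  have e2 := (hy.mul (hz.pow 4)).eventually_const_le (show (1 : ℝ) / 10 < 1 * tau ^ 4 by linarith)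
  have e3 := hη.eventually_le_const (show (0 : ℝ) < 1 / 20 by norm_num)
  have e4 := hc.eventually_le_const (show c < |c| + 1 by linarith [le_abs_self c])
  refine ⟨10 * (Real.exp 1 * (|c| + 1)), ?_⟩
  filter_upwards [e1, e2, e3, e4, hd1, hd2] with n e1 e2 e3 e4 hd1 hd2 m hm
  have hη0 : 0 ≤ η n := (abs_nonneg _).trans hd1
  have hn0 : (0 : ℝ) ≤ n := n.cast_nonneg
  have hm' : (m : ℝ) ≤ n + 10 := by exact_mod_cast hm
  have hle := (le_ten_mul_potential (hx0 n) (hy0 n) (hz0 n) (hu0 n) e1 e2 (ha n) (hb n) m).1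
  have hp := potential_le (hx0 n) (hy0 n) (hz0 n) (hu0 n) e1 e2 (ha n) (hb n) (h n) hd1 hd2
    (by nlinarith) m
  have hexp : Real.exp (20 * η n * m) ≤ Real.exp 1 := by
    refine Real.exp_le_exp.2 ?_
    nlinarith
  have hfin : potential (x n) (y n) (z n) (u n) (a n) (b n) m ≤ Real.exp 1 * (|c| + 1) :=
    hp.trans (mul_le_mul hexp e4
      (by linarith [(le_ten_mul_potential (hx0 n) (hy0 n) (hz0 n) (hu0 n) e1 e2 (ha n) (hb n) 0).1,
        ha n 0, hb n 0]) (Real.exp_pos _).le)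
  constructor <;> linarith [ha n m, hb n m]

/-! ### Flattening of bounded solutions, uniformly in the parameter. -/

/-- The filter of pairs `(n, m)` with `m ≤ n + 3` and `m → ∞`. -/
def wedge : Filter (ℕ × ℕ) := comap Prod.snd atTop ⊓ 𝓟 {p | p.2 ≤ p.1 + 3}

theorem eventually_wedge {P : ℕ × ℕ → Prop} :
    (∀ᶠ p in wedge, P p) ↔ ∃ M, ∀ n m, M ≤ m → m ≤ n + 3 → P (n, m) := by
  rw [wedge, eventually_inf_principal, eventually_comap, eventually_atTop]
  constructor
  · rintro ⟨M, hM⟩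
    exact ⟨M, fun n m h1 h2 ↦ hM m h1 (n, m) rfl h2⟩
  · rintro ⟨M, hM⟩
    exact ⟨M, fun m h1 ⟨n, _⟩ h2 h3 ↦ by subst h2; exact hM n _ h1 h3⟩

theorem tendsto_fst_wedge : Tendsto Prod.fst wedge atTop := by
  rw [tendsto_atTop]
  intro N
  rw [eventually_wedge]
  exact ⟨N + 3, fun n m h1 h2 ↦ by simp only; omega⟩

theorem tendsto_diag_wedge {j : ℕ} (hj : j ≤ 3) : Tendsto (fun n ↦ (n, n + j)) atTop wedge := by
  intro s hs
  obtain ⟨M, hM⟩ := eventually_wedge.1 hs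
  rw [mem_map]
  filter_upwards [eventually_ge_atTop M] with n hn
  exact hM n (n + j) (by omega) (by omega)

/-- Iterating `i` times leaves at most `‖c‖ ^ i * C` from the bound plus a geometric sum of small
errors. The error threshold `δ * (1 - ‖c‖)` makes `δ` a fixed point of the estimate. This removes
one characteristic factor inside the unit disc. -/
theorem tendsto_zero_of_contraction {u v : ℕ → ℕ → ℂ} {c : ℂ} {j : ℕ} (hc : ‖c‖ < 1) {C : ℝ}
    (hu : ∀ᶠ p in wedge, ‖u p.1 p.2‖ ≤ C) (hv : Tendsto (fun p ↦ v p.1 p.2) wedge (𝓝 0))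
    (h : ∀ n m, u n (m + j) = c * u n m + v n m) :
    Tendsto (fun p ↦ u p.1 p.2) wedge (𝓝 0) := by
  have key : ∀ δ > 0, ∀ i : ℕ, ∀ᶠ p in wedge, ‖u p.1 p.2‖ ≤ ‖c‖ ^ i * C + δ := by
    intro δ hδ i
    have hδ' : 0 < δ * (1 - ‖c‖) := mul_pos hδ (by linarith)
    obtain ⟨M₁, h₁⟩ := eventually_wedge.1
      ((tendsto_zero_iff_norm_tendsto_zero.1 hv).eventually_le_const hδ')
    induction i with
    | zero =>
      filter_upwards [hu] with p hp
      simp only [pow_zero, one_mul]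
      linarith
    | succ i ih =>
      obtain ⟨M₂, h₂⟩ := eventually_wedge.1 ih
      refine eventually_wedge.2 ⟨max M₁ M₂ + j, fun n m hm hmn ↦ ?_⟩
      obtain ⟨k, rfl⟩ : ∃ k, m = k + j := ⟨m - j, by omega⟩
      have hk : max M₁ M₂ ≤ k := by omega
      have b1 := h₁ n k ((le_max_left _ _).trans hk) (by omega)
      have b2 := h₂ n k ((le_max_right _ _).trans hk) (by omega)
      simp only at b1 b2 ⊢
      rw [h]
      calc ‖c * u n k + v n k‖ ≤ ‖c‖ * ‖u n k‖ + ‖v n k‖ := by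
            rw [← norm_mul]; exact norm_add_le _ _
        _ ≤ ‖c‖ * (‖c‖ ^ i * C + δ) + δ * (1 - ‖c‖) := by gcongr
        _ = ‖c‖ ^ (i + 1) * C + δ := by ring
  rw [tendsto_zero_iff_norm_tendsto_zero]
  refine tendsto_order.2 ⟨fun a ha ↦ Eventually.of_forall fun p ↦ ha.trans_le (norm_nonneg _),
    fun δ hδ ↦ ?_⟩
  have hlim : Tendsto (fun i : ℕ ↦ ‖c‖ ^ i * C + δ / 2) atTop (𝓝 (0 * C + δ / 2)) :=
    ((tendsto_pow_atTop_nhds_zero_of_lt_one (norm_nonneg _) hc).mul_const C).add_const _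
  obtain ⟨i, hi⟩ := (hlim.eventually_lt_const (show 0 * C + δ / 2 < δ by linarith)).exists
  filter_upwards [key (δ / 2) (by linarith) i] with p hp
  exact hp.trans_lt hi

section Convergence

variable {x y z u : ℕ → ℂ} {η : ℕ → ℝ} {a b : ℕ → ℕ → ℂ} {C : ℝ}

theorem tendsto_mul_wedge (k : ℕ) (hk : k ≤ 7) {f : ℕ → ℂ} (hf : Tendsto f atTop (𝓝 0))
    (ha : ∀ᶠ n in atTop, ∀ m ≤ n + 10, ‖a n m‖ ≤ C) :
    Tendsto (fun p : ℕ × ℕ ↦ f p.1 * a p.1 (p.2 + k)) wedge (𝓝 0) := by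
  refine squeeze_zero_norm' (a := fun p : ℕ × ℕ ↦ ‖f p.1‖ * C) ?_ ?_
  · have h1 := tendsto_fst_wedge.eventually ha
    have h2 : ∀ᶠ p : ℕ × ℕ in wedge, p.2 ≤ p.1 + 3 := eventually_wedge.2 ⟨0, fun _ _ _ h ↦ h⟩
    filter_upwards [h1, h2] with p h1 h2
    rw [norm_mul]
    exact mul_le_mul_of_nonneg_left (h1 _ (by omega)) (norm_nonneg _)
  · have := (hf.norm.comp tendsto_fst_wedge).mul_const C
    simpa using this

/-- The error committed by replacing the coefficients of the recursion by their limits. -/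
noncomputable def recursionError (x z : ℕ → ℂ) (a b : ℕ → ℕ → ℂ) (n m : ℕ) : ℂ :=
  (z n - tau) * a n (m + 3) + (x n * z n ^ 4 - tau ^ 4) * a n (m + 0) +
    (x n * z n ^ 3 - tau ^ 3) * b n (m + 1)

theorem tendsto_recursionError (hx : Tendsto x atTop (𝓝 1)) (hz : Tendsto z atTop (𝓝 (tau : ℂ)))
    (ha : ∀ᶠ n in atTop, ∀ m ≤ n + 10, ‖a n m‖ ≤ C)
    (hb : ∀ᶠ n in atTop, ∀ m ≤ n + 10, ‖b n m‖ ≤ C) :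
    Tendsto (fun p : ℕ × ℕ ↦ recursionError x z a b p.1 p.2) wedge (𝓝 0) := by
  have h1 : Tendsto (fun n ↦ z n - tau) atTop (𝓝 0) := by simpa using hz.sub_const (tau : ℂ)
  have h2 : Tendsto (fun n ↦ x n * z n ^ 4 - tau ^ 4) atTop (𝓝 0) := by
    exact tendsto_sub_nhds_zero_iff.2 (by simpa using hx.mul (hz.pow 4))
  have h3 : Tendsto (fun n ↦ x n * z n ^ 3 - tau ^ 3) atTop (𝓝 0) := by
    exact tendsto_sub_nhds_zero_iff.2 (by simpa using hx.mul (hz.pow 3))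
  simpa [recursionError] using ((tendsto_mul_wedge 3 (by norm_num) h1 ha).add
    (tendsto_mul_wedge 0 (by norm_num) h2 ha)).add (tendsto_mul_wedge 1 (by norm_num) h3 hb)

theorem eventually_wedge_le (ha : ∀ᶠ n in atTop, ∀ m ≤ n + 10, ‖a n m‖ ≤ C) :
    ∀ᶠ p : ℕ × ℕ in wedge, ∀ k ≤ 7, ‖a p.1 (p.2 + k)‖ ≤ C := by
  have h1 := tendsto_fst_wedge.eventually ha
  have h2 : ∀ᶠ p : ℕ × ℕ in wedge, p.2 ≤ p.1 + 3 := eventually_wedge.2 ⟨0, fun _ _ _ h ↦ h⟩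
  filter_upwards [h1, h2] with p h1 h2 k hk
  exact h1 _ (by omega)

variable (hx : Tendsto x atTop (𝓝 1)) (hy : Tendsto y atTop (𝓝 1))
  (hz : Tendsto z atTop (𝓝 (tau : ℂ)))
  (ha : ∀ᶠ n in atTop, ∀ m ≤ n + 10, ‖a n m‖ ≤ C)
  (hb : ∀ᶠ n in atTop, ∀ m ≤ n + 10, ‖b n m‖ ≤ C)
  (h : ∀ n, IsNormalized (x n) (y n) (z n) (a n) (b n))

include hx hy hz ha hb h

/-- With limiting coefficients, the characteristic polynomial of `a - b` is λ⁴ - τλ³ + τ³λ - τ⁴ = (λ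
- τ)(λ³ + τ³). Its two factors are removed in turn, so the difference dies out. -/
theorem tendsto_sub_wedge : Tendsto (fun p : ℕ × ℕ ↦ a p.1 p.2 - b p.1 p.2) wedge (𝓝 0) := by
  have ht := tau_pos
  have ht1 := tau_lt
  have ba := eventually_wedge_le ha
  have bb := eventually_wedge_le hb
  have hE := (tendsto_recursionError hx hz ha hb).sub (tendsto_recursionError hy hz hb ha)
  rw [sub_zero] at hE
  have hbd : ∀ᶠ p : ℕ × ℕ in wedge, ∀ k ≤ 7, ‖a p.1 (p.2 + k) - b p.1 (p.2 + k)‖ ≤ C + C := by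
    filter_upwards [ba, bb] with p ba bb k hk
    exact (norm_sub_le _ _).trans (add_le_add (ba k hk) (bb k hk))
  have hQ : Tendsto (fun p : ℕ × ℕ ↦ (a p.1 (p.2 + 3) - b p.1 (p.2 + 3)) +
      (tau : ℂ) ^ 3 * (a p.1 p.2 - b p.1 p.2)) wedge (𝓝 0) := by
    refine tendsto_zero_of_contraction (u := fun n m ↦ (a n (m + 3) - b n (m + 3)) +
      (tau : ℂ) ^ 3 * (a n m - b n m))
      (v := fun n m ↦ recursionError x z a b n m - recursionError y z b a n m)
      (c := (tau : ℂ)) (j := 1) (by rw [norm_tau]; linarith)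
      (C := (C + C) + tau ^ 3 * (C + C)) ?_ hE ?_
    · filter_upwards [hbd] with p hp
      refine (norm_add_le _ _).trans (add_le_add (hp 3 (by norm_num)) ?_)
      rw [norm_mul, norm_pow, norm_tau]
      exact mul_le_mul_of_nonneg_left (hp 0 (by norm_num)) (by positivity)
    · intro n m
      obtain ⟨h1, h2⟩ := h n m
      simp only [recursionError, add_zero, show m + 1 + 3 = m + 4 by ring]
      linear_combination h1 - h2
  refine tendsto_zero_of_contraction (u := fun n m ↦ a n m - b n m)
    (v := fun n m ↦ (a n (m + 3) - b n (m + 3)) + (tau : ℂ) ^ 3 * (a n m - b n m))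
    (c := -(tau : ℂ) ^ 3) (j := 3) (C := C + C) ?_ ?_ hQ ?_
  · rw [norm_neg, norm_pow, norm_tau]
    exact pow_lt_one₀ ht.le (by linarith) (by norm_num)
  · filter_upwards [hbd] with p hp using hp 0 (by norm_num)
  · intro n m
    ring

/-- For `a + b` the limiting polynomial is λ⁴ - τλ³ - τ³λ - τ⁴ = (λ² + τ²)(λ² - τλ - τ²), and τ² = 1
- τ splits the last factor as (λ - 1)(λ + τ²). Removing all but λ - 1 leaves the first difference.
-/
theorem tendsto_succ_sub_wedge :
    Tendsto (fun p : ℕ × ℕ ↦ (a p.1 (p.2 + 1) + b p.1 (p.2 + 1)) - (a p.1 p.2 + b p.1 p.2))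
      wedge (𝓝 0) := by
  have ht := tau_pos
  have ht1 := tau_lt
  have ba := eventually_wedge_le ha
  have bb := eventually_wedge_le hb
  have hE := (tendsto_recursionError hx hz ha hb).add (tendsto_recursionError hy hz hb ha)
  rw [add_zero] at hE
  have hbd : ∀ᶠ p : ℕ × ℕ in wedge, ∀ k ≤ 7, ‖a p.1 (p.2 + k) + b p.1 (p.2 + k)‖ ≤ C + C := by
    filter_upwards [ba, bb] with p ba bb k hk
    exact (norm_add_le _ _).trans (add_le_add (ba k hk) (bb k hk))
  have hc : ‖-(tau : ℂ) ^ 2‖ < 1 := by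
    rw [norm_neg, norm_pow, norm_tau]
    exact pow_lt_one₀ ht.le (by linarith) (by norm_num)
  have hV : Tendsto (fun p : ℕ × ℕ ↦ (a p.1 (p.2 + 2) + b p.1 (p.2 + 2)) -
      tau * (a p.1 (p.2 + 1) + b p.1 (p.2 + 1)) - (tau : ℂ) ^ 2 * (a p.1 p.2 + b p.1 p.2))
      wedge (𝓝 0) := by
    refine tendsto_zero_of_contraction (u := fun n m ↦ (a n (m + 2) + b n (m + 2)) -
      tau * (a n (m + 1) + b n (m + 1)) - (tau : ℂ) ^ 2 * (a n m + b n m))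
      (v := fun n m ↦ recursionError x z a b n m + recursionError y z b a n m) (j := 2) hc
      (C := (C + C) + tau * (C + C) + tau ^ 2 * (C + C)) ?_ hE ?_
    · filter_upwards [hbd] with p hp
      refine (norm_sub_le _ _).trans (add_le_add ((norm_sub_le _ _).trans (add_le_add
        (hp 2 (by norm_num)) ?_)) ?_)
      · rw [norm_mul, norm_tau]
        exact mul_le_mul_of_nonneg_left (hp 1 (by norm_num)) (by positivity)
      · rw [norm_mul, norm_pow, norm_tau]
        exact mul_le_mul_of_nonneg_left (hp 0 (by norm_num)) (by positivity)
    · intro n m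
      obtain ⟨h1, h2⟩ := h n m
      simp only [recursionError, add_zero, show m + 2 + 2 = m + 4 by ring,
        show m + 2 + 1 = m + 3 by ring]
      linear_combination h1 + h2
  refine tendsto_zero_of_contraction (u := fun n m ↦ (a n (m + 1) + b n (m + 1)) -
    (a n m + b n m)) (v := fun n m ↦ (a n (m + 2) + b n (m + 2)) -
      tau * (a n (m + 1) + b n (m + 1)) - (tau : ℂ) ^ 2 * (a n m + b n m)) (j := 1) hc
    (C := (C + C) + (C + C)) ?_ hV ?_
  · filter_upwards [hbd] with p hp
    exact (norm_sub_le _ _).trans (add_le_add (hp 1 (by norm_num)) (hp 0 (by norm_num)))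
  · intro n m
    simp only [show m + 1 + 1 = m + 2 by ring]
    linear_combination (a n (m + 1) + b n (m + 1)) * tau_sq_complex

theorem tendsto_diag_of_isNormalized (hu : Tendsto u atTop (𝓝 1)) {c : ℂ}
    (hd1 : ∀ᶠ n in atTop, ‖defect₁ (x n) (y n) (z n) (u n)‖ ≤ η n)
    (hd2 : ∀ᶠ n in atTop, ‖defect₂ (x n) (y n) (z n) (u n)‖ ≤ η n)
    (hη : Tendsto (fun n : ℕ ↦ ((n : ℝ) + 10) * η n) atTop (𝓝 0))
    (hc : Tendsto (fun n ↦ potential (x n) (y n) (z n) (u n) (a n) (b n) 0) atTop (𝓝 c)) :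
    Tendsto (fun n ↦ a n n) atTop (𝓝 (c / (10 * tau ^ 2))) := by
  have hpot : Tendsto (fun n ↦ potential (x n) (y n) (z n) (u n) (a n) (b n) n) atTop (𝓝 c) := by
    have hdiff : Tendsto (fun n ↦ potential (x n) (y n) (z n) (u n) (a n) (b n) n -
        potential (x n) (y n) (z n) (u n) (a n) (b n) 0) atTop (𝓝 0) := by
      -- Each of the `n` steps moves the potential by at most `2 * η n * C`.
      refine squeeze_zero_norm' (a := fun n : ℕ ↦ ((n : ℝ) + 10) * η n * (2 * C)) ?_
        (by simpa using hη.mul_const (2 * C))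
      filter_upwards [ha, hb, hd1, hd2] with n ha hb hd1 hd2
      have hη0 : 0 ≤ η n := (norm_nonneg _).trans hd1
      have hC : 0 ≤ C := (norm_nonneg _).trans (ha 0 (by omega))
      have step : ∀ m ≤ n, ‖potential (x n) (y n) (z n) (u n) (a n) (b n) m -
          potential (x n) (y n) (z n) (u n) (a n) (b n) 0‖ ≤ m * η n * (2 * C) := by
        intro m hm
        induction m with
        | zero => simp
        | succ m ih =>
          have e : potential (x n) (y n) (z n) (u n) (a n) (b n) (m + 1) -
              potential (x n) (y n) (z n) (u n) (a n) (b n) 0 =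
              (potential (x n) (y n) (z n) (u n) (a n) (b n) m -
                potential (x n) (y n) (z n) (u n) (a n) (b n) 0) -
              defect₁ (x n) (y n) (z n) (u n) * a n (m + 4) -
              defect₂ (x n) (y n) (z n) (u n) * b n (m + 4) := by
            rw [potential_succ (u n) (h n) m]
            ring
          rw [e]
          have e1 : ‖defect₁ (x n) (y n) (z n) (u n) * a n (m + 4)‖ ≤ η n * C := by
            rw [norm_mul]
            exact mul_le_mul hd1 (ha _ (by omega)) (norm_nonneg _) hη0
          have e2 : ‖defect₂ (x n) (y n) (z n) (u n) * b n (m + 4)‖ ≤ η n * C := by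
            rw [norm_mul]
            exact mul_le_mul hd2 (hb _ (by omega)) (norm_nonneg _) hη0
          refine (norm_sub_le _ _).trans ((add_le_add ((norm_sub_le _ _).trans
            (add_le_add (ih (by omega)) e1)) e2).trans (le_of_eq ?_))
          push_cast
          ring
      refine (step n le_rfl).trans ?_
      gcongr
      linarith
    simpa using hdiff.add hc
  have hs := tendsto_sub_wedge hx hy hz ha hb h
  have hr := tendsto_succ_sub_wedge hx hy hz ha hb h
  have s0 := hs.comp (tendsto_diag_wedge (j := 0) (by norm_num))
  have s1 := hs.comp (tendsto_diag_wedge (j := 1) (by norm_num))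
  have s2 := hs.comp (tendsto_diag_wedge (j := 2) (by norm_num))
  have s3 := hs.comp (tendsto_diag_wedge (j := 3) (by norm_num))
  have r0 := hr.comp (tendsto_diag_wedge (j := 0) (by norm_num))
  have r1 := hr.comp (tendsto_diag_wedge (j := 1) (by norm_num))
  have r2 := hr.comp (tendsto_diag_wedge (j := 2) (by norm_num))
  have half : Tendsto (fun _ : ℕ ↦ (1 / 2 : ℂ)) atTop (𝓝 (1 / 2)) := tendsto_const_nhds
  -- Increments of `a` are half the increments of `a + b` and of `a - b` together.
  have a1 : Tendsto (fun n ↦ a n (n + 1) - a n n) atTop (𝓝 0) := by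
    convert! half.mul ((r0.add s1).sub s0) using 1
    · ext n; simp; ring
    · simp
  have a2 : Tendsto (fun n ↦ a n (n + 2) - a n n) atTop (𝓝 0) := by
    convert! half.mul (((r0.add r1).add s2).sub s0) using 1
    · ext n; simp [add_assoc]; ring
    · simp
  have a3 : Tendsto (fun n ↦ a n (n + 3) - a n n) atTop (𝓝 0) := by
    convert! half.mul ((((r0.add r1).add r2).add s3).sub s0) using 1
    · ext n; simp [add_assoc]; ring
    · simp
  have b0 : Tendsto (fun n ↦ b n n - a n n) atTop (𝓝 0) := by
    simpa using s0.neg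
  have b1 : Tendsto (fun n ↦ b n (n + 1) - a n n) atTop (𝓝 0) := by
    simpa using a1.sub s1
  have b2 : Tendsto (fun n ↦ b n (n + 2) - a n n) atTop (𝓝 0) := by
    simpa using a2.sub s2
  have b3 : Tendsto (fun n ↦ b n (n + 3) - a n n) atTop (𝓝 0) := by
    simpa using a3.sub s3
  have a0 : Tendsto (fun n ↦ a n n - a n n) atTop (𝓝 0) := by simp
  -- Total weight of the eight entries in the potential; in the limit it is 2(τ + 3τ³ + 4τ⁴) = 10τ².
  -- Since all entries nearly equal `a n n`, dividing by it recovers the limit.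
  have hw : Tendsto (fun n ↦ u n * z n + y n * z n ^ 3 * 3 + u n * x n * z n ^ 4 * 4 +
      (z n + x n * u n * z n ^ 3 * 3 + y n * z n ^ 4 * 4)) atTop (𝓝 (10 * (tau : ℂ) ^ 2)) := by
    have := (((hu.mul hz).add ((hy.mul (hz.pow 3)).mul_const 3)).add
      (((hu.mul hx).mul (hz.pow 4)).mul_const 4)).add ((hz.add
        (((hx.mul hu).mul (hz.pow 3)).mul_const 3)).add ((hy.mul (hz.pow 4)).mul_const 4))
    convert! this using 2
    linear_combination (-(8 * (tau : ℂ) ^ 2) + 2 * tau) * tau_sq_complex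
  have hne : (10 * (tau : ℂ) ^ 2) ≠ 0 := by
    exact_mod_cast (show 10 * tau ^ 2 ≠ 0 by have := tau_pos; positivity)
  have herr : Tendsto (fun n ↦ potential (x n) (y n) (z n) (u n)
      (fun m ↦ a n m - a n n) (fun m ↦ b n m - a n n) n) atTop (𝓝 0) := by
    have := ((((hu.mul hz).mul a3).add ((hy.mul (hz.pow 3)).mul ((a3.add a2).add a1))).add
      (((hu.mul hx).mul (hz.pow 4)).mul (((a3.add a2).add a1).add a0))).add ((((hz.mul b3)).add
        (((hx.mul hu).mul (hz.pow 3)).mul ((b3.add b2).add b1))).add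
          ((hy.mul (hz.pow 4)).mul (((b3.add b2).add b1).add b0)))
    simpa [potential] using this
  have hmain := (hpot.sub herr).div hw hne
  rw [sub_zero] at hmain
  refine hmain.congr' ?_
  filter_upwards [hw.eventually_ne hne] with n hn
  rw [Pi.div_apply, div_eq_iff hn]
  simp only [potential]
  ring

end Convergence

/-! ### Second-order approximation of the dominant singularity and the null vector. -/

/-- The exponential of the quadratic polynomial `p ε + q ε ^ 2`. -/
noncomputable def quadExp (p q ε : ℂ) : ℂ := Complex.exp (p * ε + q * ε ^ 2)

theorem quadExp_mul (p q p' q' ε : ℂ) :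
    quadExp p q ε * quadExp p' q' ε = quadExp (p + p') (q + q') ε := by
  simp only [quadExp, ← Complex.exp_add]
  ring_nf

theorem quadExp_pow (p q ε : ℂ) (n : ℕ) : quadExp p q ε ^ n = quadExp (n * p) (n * q) ε := by
  simp only [quadExp, ← Complex.exp_nat_mul]
  ring_nf

@[simp] theorem quadExp_zero (p q : ℂ) : quadExp p q 0 = 1 := by simp [quadExp]

theorem continuous_quadExp (p q : ℂ) : Continuous (quadExp p q) := by
  unfold quadExp
  fun_prop

theorem norm_quadExp (p q : ℝ) (ε : ℂ) :
    ‖quadExp p q ε‖ = Real.exp (p * ε.re + q * ε.re ^ 2) * Real.exp (-q * ε.im ^ 2) := by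
  rw [quadExp, Complex.norm_exp, ← Real.exp_add]
  congr 1
  simp [sq, Complex.mul_re, Complex.mul_im]
  ring

theorem quadExp_ofReal (p q e : ℝ) : quadExp p q e = (Real.exp (p * e + q * e ^ 2) : ℝ) := by
  simp [quadExp]

theorem quadExp_sub_isBigO (p q : ℂ) :
    (fun ε ↦ quadExp p q ε - (1 + p * ε + (q + p ^ 2 / 2) * ε ^ 2)) =O[𝓝 0] fun ε ↦ ε ^ 3 := by
  have hlin : (fun ε : ℂ ↦ p * ε + q * ε ^ 2) =O[𝓝 0] fun ε ↦ ε := by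
    have h2 : (fun ε : ℂ ↦ ε ^ 2) =O[𝓝 0] fun ε ↦ ε := by
      exact (Asymptotics.isLittleO_pow_id one_lt_two).isBigO
    exact ((Asymptotics.isBigO_refl _ _).const_mul_left p).add (h2.const_mul_left q)
  have hzero : Tendsto (fun ε : ℂ ↦ p * ε + q * ε ^ 2) (𝓝 0) (𝓝 0) := by
    have : Continuous fun ε : ℂ ↦ p * ε + q * ε ^ 2 := by fun_prop
    simpa using this.tendsto 0
  have h1 := ((Complex.exp_sub_sum_range_isBigO_pow 3).comp_tendsto hzero).trans (hlin.pow 3)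
  have h4 : (fun ε : ℂ ↦ (p * q + q ^ 2 / 2 * ε) * ε ^ 3) =O[𝓝 0] fun ε ↦ ε ^ 3 := by
    have hb : (fun ε : ℂ ↦ p * q + q ^ 2 / 2 * ε) =O[𝓝 0] fun _ ↦ (1 : ℂ) := by
      have : Continuous fun ε : ℂ ↦ p * q + q ^ 2 / 2 * ε := by fun_prop
      exact (this.tendsto 0).isBigO_one ℂ
    simpa using hb.mul (Asymptotics.isBigO_refl (fun ε : ℂ ↦ ε ^ 3) (𝓝 0))
  refine (h1.add h4).congr_left fun ε ↦ ?_
  simp [quadExp, Finset.sum_range_succ, Nat.factorial]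
  ring

/-- The limiting mean per index of `α` times the number of positive summands plus `β` times the
number of negative summands. -/
noncomputable def asympMean (α β : ℝ) : ℝ := (α + β) / 10

/-- The limiting variance per index of `α` times the number of positive summands plus `β` times
the number of negative summands. -/
noncomputable def asympVar (α β : ℝ) : ℝ :=
  (α + β) ^ 2 * (2 * tau + 1) / 250 + (α - β) ^ 2 * tau / 20

theorem asympVar_nonneg (α β : ℝ) : 0 ≤ asympVar α β := by
  have := tau_pos
  unfold asympVar
  positivity

/-- The approximate dominant singularity of the generating function along a line. -/
noncomputable def root (α β : ℝ) (ε : ℂ) : ℂ :=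
  tau * quadExp ((-asympMean α β : ℝ) : ℂ) ((-(asympVar α β / 2) : ℝ) : ℂ) ε

/-- The approximate ratio of the weights of positive and negative leading terms. -/
noncomputable def weight (α β : ℝ) (ε : ℂ) : ℂ :=
  quadExp ((-((α - β) * tau ^ 2 / 2) : ℝ) : ℂ) ((-((α ^ 2 - β ^ 2) * tau / 20) : ℝ) : ℂ) ε

/-- Every term of the defect is a constant times a `quadExp`, so only the coefficients of 1, ε and
ε² need to vanish. The exponents in `root` and `weight`, and thus `asympMean` and `asympVar`, make
these coefficients vanish in both defects. -/
theorem defect₁_isBigO (α β : ℝ) :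
    (fun ε ↦ defect₁ (quadExp α (0 : ℝ) ε) (quadExp β (0 : ℝ) ε) (root α β ε) (weight α β ε))
      =O[𝓝 0] fun ε ↦ ε ^ 3 := by
  set g₁ : ℂ := ((-((α - β) * tau ^ 2 / 2) : ℝ) : ℂ) with hg₁
  set g₂ : ℂ := ((-((α ^ 2 - β ^ 2) * tau / 20) : ℝ) : ℂ) with hg₂
  set μ : ℂ := ((-asympMean α β : ℝ) : ℂ) with hμ
  set κ : ℂ := ((-(asympVar α β / 2) : ℝ) : ℂ) with hκ
  have hexp : ∀ ε, defect₁ (quadExp α (0 : ℝ) ε) (quadExp β (0 : ℝ) ε) (root α β ε)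
      (weight α β ε) = quadExp g₁ g₂ ε - tau * quadExp (g₁ + μ) (g₂ + κ) ε -
        tau ^ 4 * quadExp (g₁ + α + 4 * μ) (g₂ + 0 + 4 * κ) ε -
        tau ^ 3 * quadExp (β + 3 * μ) (0 + 3 * κ) ε := by
    intro ε
    simp only [← quadExp_mul]
    have h3 := quadExp_pow μ κ ε 3
    have h4 := quadExp_pow μ κ ε 4
    push_cast at h3 h4
    simp only [defect₁, root, weight, ← h3, ← h4, ← hμ, ← hκ, ← hg₁, ← hg₂, Complex.ofReal_zero]
    ring
  have hsum := (((quadExp_sub_isBigO g₁ g₂).sub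
    ((quadExp_sub_isBigO (g₁ + μ) (g₂ + κ)).const_mul_left (tau : ℂ))).sub
    ((quadExp_sub_isBigO (g₁ + α + 4 * μ) (g₂ + 0 + 4 * κ)).const_mul_left ((tau : ℂ) ^ 4))).sub
    ((quadExp_sub_isBigO (β + 3 * μ) (0 + 3 * κ)).const_mul_left ((tau : ℂ) ^ 3))
  refine hsum.congr_left fun ε ↦ ?_
  rw [hexp]
  -- `h0`, `h1`, `h2` are the coefficients of 1, ε, ε²; each is a polynomial multiple of τ² + τ - 1.
  have h0 : (1 : ℂ) - tau - tau ^ 4 - tau ^ 3 = 0 := by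
    linear_combination (-(tau : ℂ) ^ 2 - 1) * tau_sq_complex
  have h1 : g₁ - tau * (g₁ + μ) - tau ^ 4 * (g₁ + α + 4 * μ) - tau ^ 3 * (β + 3 * μ) = 0 := by
    simp only [hg₁, hμ, asympMean]
    push_cast
    linear_combination ((-1/10) * (tau : ℂ) * (β : ℂ) + (-1/10) * (tau : ℂ) * (α : ℂ) + (-3/5) *
      (tau : ℂ) ^ 2 * (β : ℂ) + (2/5) * (tau : ℂ) ^ 2 * (α : ℂ) + (1/2) * (tau : ℂ) ^ 3 * (β
      : ℂ) + (-1/2) * (tau : ℂ) ^ 3 * (α : ℂ) + (-1/2) * (tau : ℂ) ^ 4 * (β : ℂ) + (1/2) *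
      (tau : ℂ) ^ 4 * (α : ℂ)) * tau_sq_complex
  have h2 : (g₂ + g₁ ^ 2 / 2) - tau * (g₂ + κ + (g₁ + μ) ^ 2 / 2) -
      tau ^ 4 * (g₂ + 0 + 4 * κ + (g₁ + α + 4 * μ) ^ 2 / 2) -
      tau ^ 3 * (0 + 3 * κ + (β + 3 * μ) ^ 2 / 2) = 0 := by
    simp only [hg₁, hg₂, hμ, hκ, asympMean, asympVar]
    push_cast
    linear_combination ((-47/1000) * (tau : ℂ) * (β : ℂ) ^ 2 + (3/500) * (tau : ℂ) * (α : ℂ) *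
      (β : ℂ) + (53/1000) * (tau : ℂ) * (α : ℂ) ^ 2 + (-13/500) * (tau : ℂ) ^ 2 * (β : ℂ) ^
      2 + (6/125) * (tau : ℂ) ^ 2 * (α : ℂ) * (β : ℂ) + (-13/500) * (tau : ℂ) ^ 2 * (α : ℂ)
      ^ 2 + (29/250) * (tau : ℂ) ^ 3 * (β : ℂ) ^ 2 + (-21/125) * (tau : ℂ) ^ 3 * (α : ℂ) *
      (β : ℂ) + (29/250) * (tau : ℂ) ^ 3 * (α : ℂ) ^ 2 + (-1/20) * (tau : ℂ) ^ 4 * (β : ℂ) ^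
      2 + (1/20) * (tau : ℂ) ^ 4 * (α : ℂ) ^ 2 + (1/8) * (tau : ℂ) ^ 5 * (β : ℂ) ^ 2 +
      (-1/4) * (tau : ℂ) ^ 5 * (α : ℂ) * (β : ℂ) + (1/8) * (tau : ℂ) ^ 5 * (α : ℂ) ^ 2 +
      (-1/8) * (tau : ℂ) ^ 6 * (β : ℂ) ^ 2 + (1/4) * (tau : ℂ) ^ 6 * (α : ℂ) * (β : ℂ) +
      (-1/8) * (tau : ℂ) ^ 6 * (α : ℂ) ^ 2) * tau_sq_complex
  linear_combination -h0 - ε * h1 - ε ^ 2 * h2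

theorem defect₂_isBigO (α β : ℝ) :
    (fun ε ↦ defect₂ (quadExp α (0 : ℝ) ε) (quadExp β (0 : ℝ) ε) (root α β ε) (weight α β ε))
      =O[𝓝 0] fun ε ↦ ε ^ 3 := by
  set g₁ : ℂ := ((-((α - β) * tau ^ 2 / 2) : ℝ) : ℂ) with hg₁
  set g₂ : ℂ := ((-((α ^ 2 - β ^ 2) * tau / 20) : ℝ) : ℂ) with hg₂
  set μ : ℂ := ((-asympMean α β : ℝ) : ℂ) with hμ
  set κ : ℂ := ((-(asympVar α β / 2) : ℝ) : ℂ) with hκ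
  have hexp : ∀ ε, defect₂ (quadExp α (0 : ℝ) ε) (quadExp β (0 : ℝ) ε) (root α β ε)
      (weight α β ε) = 1 - tau * quadExp μ κ ε -
        tau ^ 4 * quadExp (β + 4 * μ) (0 + 4 * κ) ε -
        tau ^ 3 * quadExp (α + g₁ + 3 * μ) (0 + g₂ + 3 * κ) ε := by
    intro ε
    simp only [← quadExp_mul]
    have h3 := quadExp_pow μ κ ε 3
    have h4 := quadExp_pow μ κ ε 4
    push_cast at h3 h4
    simp only [defect₂, root, weight, ← h3, ← h4, ← hμ, ← hκ, ← hg₁, ← hg₂, Complex.ofReal_zero]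
    ring
  have hsum := (((quadExp_sub_isBigO μ κ).const_mul_left (-(tau : ℂ))).sub
    ((quadExp_sub_isBigO (β + 4 * μ) (0 + 4 * κ)).const_mul_left ((tau : ℂ) ^ 4))).sub
    ((quadExp_sub_isBigO (α + g₁ + 3 * μ) (0 + g₂ + 3 * κ)).const_mul_left ((tau : ℂ) ^ 3))
  refine hsum.congr_left fun ε ↦ ?_
  rw [hexp]
  have h0 : (1 : ℂ) - tau - tau ^ 4 - tau ^ 3 = 0 := by
    linear_combination (-(tau : ℂ) ^ 2 - 1) * tau_sq_complex
  have h1 : -(tau * μ) - tau ^ 4 * (β + 4 * μ) - tau ^ 3 * (α + g₁ + 3 * μ) = 0 := by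
    simp only [hg₁, hμ, asympMean]
    push_cast
    linear_combination ((-1/10) * (tau : ℂ) * (β : ℂ) + (-1/10) * (tau : ℂ) * (α : ℂ) + (-1/10)
      * (tau : ℂ) ^ 2 * (β : ℂ) + (-1/10) * (tau : ℂ) ^ 2 * (α : ℂ) + (-1/2) * (tau : ℂ) ^ 3
      * (β : ℂ) + (1/2) * (tau : ℂ) ^ 3 * (α : ℂ)) * tau_sq_complex
  have h2 : -(tau * (κ + μ ^ 2 / 2)) - tau ^ 4 * (0 + 4 * κ + (β + 4 * μ) ^ 2 / 2) -
      tau ^ 3 * (0 + g₂ + 3 * κ + (α + g₁ + 3 * μ) ^ 2 / 2) = 0 := by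
    simp only [hg₁, hg₂, hμ, hκ, asympMean, asympVar]
    push_cast
    linear_combination ((3/1000) * (tau : ℂ) * (β : ℂ) ^ 2 + (3/500) * (tau : ℂ) * (α : ℂ) * (β
      : ℂ) + (3/1000) * (tau : ℂ) * (α : ℂ) ^ 2 + (-13/500) * (tau : ℂ) ^ 2 * (β : ℂ) ^ 2 +
      (6/125) * (tau : ℂ) ^ 2 * (α : ℂ) * (β : ℂ) + (-13/500) * (tau : ℂ) ^ 2 * (α : ℂ) ^ 2
      + (2/125) * (tau : ℂ) ^ 3 * (β : ℂ) ^ 2 + (-21/125) * (tau : ℂ) ^ 3 * (α : ℂ) * (β :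
      ℂ) + (27/125) * (tau : ℂ) ^ 3 * (α : ℂ) ^ 2 + (1/8) * (tau : ℂ) ^ 4 * (β : ℂ) ^ 2 +
      (-1/4) * (tau : ℂ) ^ 4 * (α : ℂ) * (β : ℂ) + (1/8) * (tau : ℂ) ^ 4 * (α : ℂ) ^ 2 +
      (-1/8) * (tau : ℂ) ^ 5 * (β : ℂ) ^ 2 + (1/4) * (tau : ℂ) ^ 5 * (α : ℂ) * (β : ℂ) +
      (-1/8) * (tau : ℂ) ^ 5 * (α : ℂ) ^ 2) * tau_sq_complex
  linear_combination -h0 - ε * h1 - ε ^ 2 * h2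

/-! ### Asymptotics of the generating functions at scale 1/√n. -/

theorem norm_gen_le (x y : ℂ) (m : ℕ) : ‖gen x y m‖ ≤ gen ‖x‖ ‖y‖ m := by
  refine (norm_sum_le _ _).trans (le_of_eq (Finset.sum_congr rfl fun N _ ↦ ?_))
  simp [monomial]

theorem gen_nonneg {x y : ℝ} (hx : 0 ≤ x) (hy : 0 ≤ y) (m : ℕ) : 0 ≤ gen x y m :=
  Finset.sum_nonneg fun _ _ ↦ mul_nonneg (pow_nonneg hx _) (pow_nonneg hy _)

theorem gen_one_pos (m : ℕ) : (0 : ℝ) < gen (1 : ℝ) 1 m := by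
  have := S_lt_succ m
  refine Finset.sum_pos (fun N _ ↦ by simp [monomial]) (Finset.nonempty_Ioc.2 this)

theorem ofReal_gen (x y : ℝ) (m : ℕ) : ((gen x y m : ℝ) : ℂ) = gen (x : ℂ) (y : ℂ) m := by
  simp [gen, monomial]

theorem isNormalized_gen {R : Type*} [CommRing R] (x y z : R) :
    IsNormalized x y z (fun m ↦ z ^ m * gen x y m) (fun m ↦ z ^ m * gen y x m) := by
  intro m
  constructor
  · simp only [gen_add_four x y]
    ring
  · simp only [gen_add_four y x]
    ring

theorem tendsto_inv_sqrt : Tendsto (fun n : ℕ ↦ (√(n : ℝ))⁻¹) atTop (𝓝 0) :=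
  tendsto_inv_atTop_zero.comp (Real.tendsto_sqrt_atTop.comp tendsto_natCast_atTop_atTop)

theorem tendsto_div_sqrt (w : ℂ) : Tendsto (fun n : ℕ ↦ w / (√(n : ℝ) : ℂ)) atTop (𝓝 0) := by
  have h := (Complex.continuous_ofReal.tendsto 0).comp tendsto_inv_sqrt
  simpa [Function.comp_def, div_eq_mul_inv] using h.const_mul w

theorem norm_div_sqrt (w : ℂ) (n : ℕ) : ‖w / (√(n : ℝ) : ℂ)‖ = ‖w‖ * (√(n : ℝ))⁻¹ := by
  rw [norm_div, Complex.norm_real, Real.norm_of_nonneg (Real.sqrt_nonneg _), div_eq_mul_inv]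

theorem tendsto_mul_cube (K W : ℝ) :
    Tendsto (fun n : ℕ ↦ ((n : ℝ) + 10) * (K * (W * (√(n : ℝ))⁻¹) ^ 3)) atTop (𝓝 0) := by
  have h := (tendsto_inv_sqrt.add ((tendsto_inv_sqrt.pow 3).const_mul 10)).const_mul (K * W ^ 3)
  simp only [ne_eq, OfNat.ofNat_ne_zero, not_false_eq_true, zero_pow, mul_zero, add_zero] at h
  refine h.congr' ?_
  filter_upwards [eventually_gt_atTop 0] with n hn
  have hs : √(n : ℝ) ≠ 0 := by positivity
  have hn' : (n : ℝ) = √(n : ℝ) ^ 2 := (Real.sq_sqrt n.cast_nonneg).symm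
  nth_rewrite 3 [hn']
  field_simp

theorem root_zero (α β : ℝ) : root α β 0 = tau := by simp [root]

theorem weight_zero (α β : ℝ) : weight α β 0 = 1 := by simp [weight]

theorem continuous_root (α β : ℝ) : Continuous (root α β) :=
  continuous_const.mul (continuous_quadExp _ _)

theorem continuous_weight (α β : ℝ) : Continuous (weight α β) := continuous_quadExp _ _

theorem continuous_gen {x y : ℂ → ℂ} (hx : Continuous x) (hy : Continuous y) (m : ℕ) :
    Continuous fun ε ↦ gen (x ε) (y ε) m := by
  unfold gen monomial
  fun_prop

/-- The potential of the generating functions along the line in direction `(α, β)`. -/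
noncomputable def genPotential (α β : ℝ) (ε : ℂ) : ℂ :=
  potential (quadExp α (0 : ℝ) ε) (quadExp β (0 : ℝ) ε) (root α β ε) (weight α β ε)
    (fun m ↦ root α β ε ^ m * gen (quadExp α (0 : ℝ) ε) (quadExp β (0 : ℝ) ε) m)
    (fun m ↦ root α β ε ^ m * gen (quadExp β (0 : ℝ) ε) (quadExp α (0 : ℝ) ε) m) 0

theorem continuous_genPotential (α β : ℝ) : Continuous (genPotential α β) := by
  have h1 := continuous_quadExp α (0 : ℝ)
  have h2 := continuous_quadExp β (0 : ℝ)
  have h3 := continuous_root α β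
  have h4 := continuous_weight α β
  have h5 := fun m ↦ continuous_gen h1 h2 m
  have h6 := fun m ↦ continuous_gen h2 h1 m
  unfold genPotential potential
  fun_prop

/-- The value of the potential at the all-ones weights. -/
noncomputable def basePotential : ℝ :=
  potential 1 1 tau 1 (fun m ↦ tau ^ m * gen 1 1 m) (fun m ↦ tau ^ m * gen 1 1 m) 0

theorem genPotential_zero (α β : ℝ) : genPotential α β 0 = (basePotential : ℝ) := by
  simp only [genPotential, basePotential, quadExp_zero, root_zero, weight_zero, potential]
  push_cast [ofReal_gen]
  simp

theorem basePotential_pos : 0 < basePotential := by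
  have ht := tau_pos
  have h : ∀ m, 0 < tau ^ m * gen (1 : ℝ) 1 m := fun m ↦ mul_pos (pow_pos ht m) (gen_one_pos m)
  have h0 := h 0
  have h1 := h 1
  have h2 := h 2
  have h3 := h 3
  unfold basePotential potential
  simp only [zero_add]
  positivity

theorem exists_defect_bound (α β : ℝ) : ∃ K : ℝ, ∀ᶠ ε in 𝓝 (0 : ℂ),
    ‖defect₁ (quadExp α (0 : ℝ) ε) (quadExp β (0 : ℝ) ε) (root α β ε) (weight α β ε)‖
      ≤ K * ‖ε‖ ^ 3 ∧
    ‖defect₂ (quadExp α (0 : ℝ) ε) (quadExp β (0 : ℝ) ε) (root α β ε) (weight α β ε)‖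
      ≤ K * ‖ε‖ ^ 3 := by
  obtain ⟨K₁, h₁⟩ := (defect₁_isBigO α β).bound
  obtain ⟨K₂, h₂⟩ := (defect₂_isBigO α β).bound
  refine ⟨max K₁ K₂, ?_⟩
  filter_upwards [h₁, h₂] with ε h₁ h₂
  rw [norm_pow] at h₁ h₂
  exact ⟨h₁.trans (by gcongr; exact le_max_left _ _), h₂.trans (by gcongr; exact le_max_right _ _)⟩

theorem exists_bound_real (α β r : ℝ) : ∃ C, ∀ᶠ n : ℕ in atTop, ∀ m ≤ n + 10,
    ‖root α β (r / √(n : ℝ) : ℝ)‖ ^ m *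
      gen (Real.exp (α * (r / √(n : ℝ)))) (Real.exp (β * (r / √(n : ℝ)))) m ≤ C := by
  set e : ℕ → ℝ := fun n ↦ r / √(n : ℝ) with he
  set x : ℕ → ℝ := fun n ↦ Real.exp (α * e n) with hx
  set y : ℕ → ℝ := fun n ↦ Real.exp (β * e n) with hy
  set z : ℕ → ℝ := fun n ↦ tau * Real.exp ((-asympMean α β) * e n +
    (-(asympVar α β / 2)) * e n ^ 2) with hz
  set u : ℕ → ℝ := fun n ↦ Real.exp ((-((α - β) * tau ^ 2 / 2)) * e n +
    (-((α ^ 2 - β ^ 2) * tau / 20)) * e n ^ 2) with hu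
  have hxc : ∀ n, quadExp α (0 : ℝ) (e n : ℝ) = (x n : ℝ) := fun n ↦ by
    rw [quadExp_ofReal]; simp [hx]
  have hyc : ∀ n, quadExp β (0 : ℝ) (e n : ℝ) = (y n : ℝ) := fun n ↦ by
    rw [quadExp_ofReal]; simp [hy]
  have hzc : ∀ n, root α β (e n : ℝ) = (z n : ℝ) := fun n ↦ by
    rw [root, quadExp_ofReal]; simp [hz]
  have huc : ∀ n, weight α β (e n : ℝ) = (u n : ℝ) := fun n ↦ by
    rw [weight, quadExp_ofReal]
  have hz0 : ∀ n, 0 < z n := fun n ↦ mul_pos tau_pos (Real.exp_pos _)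
  have he0 : Tendsto e atTop (𝓝 0) := by
    simpa [he, div_eq_mul_inv] using tendsto_inv_sqrt.const_mul r
  have hec : Tendsto (fun n ↦ (e n : ℂ)) atTop (𝓝 0) := by
    simpa [Function.comp_def] using (Complex.continuous_ofReal.tendsto 0).comp he0
  have lim : ∀ {f : ℝ → ℝ} {c : ℝ}, Continuous f → f 0 = c →
      Tendsto (fun n ↦ f (e n)) atTop (𝓝 c) := fun hf hc ↦ hc ▸ (hf.tendsto 0).comp he0
  obtain ⟨K, hK⟩ := exists_defect_bound α β
  have hd := hec.eventually hK
  have hbound : ∀ n, K * ‖(e n : ℂ)‖ ^ 3 = K * (|r| * (√(n : ℝ))⁻¹) ^ 3 := by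
    intro n
    rw [Complex.norm_real, Real.norm_eq_abs, he, abs_div, abs_of_nonneg (Real.sqrt_nonneg _),
      div_eq_mul_inv]
  have hpc : ∀ n, ((potential (x n) (y n) (z n) (u n) (fun m ↦ z n ^ m * gen (x n) (y n) m)
      (fun m ↦ z n ^ m * gen (y n) (x n) m) 0 : ℝ) : ℂ) = genPotential α β (e n : ℝ) := by
    intro n
    simp only [genPotential, hxc, hyc, hzc, huc, potential]
    push_cast [ofReal_gen]
    rfl
  have hpot : Tendsto (fun n ↦ potential (x n) (y n) (z n) (u n)
      (fun m ↦ z n ^ m * gen (x n) (y n) m) (fun m ↦ z n ^ m * gen (y n) (x n) m) 0) atTop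
      (𝓝 basePotential) := by
    have h1 := ((continuous_genPotential α β).tendsto 0).comp hec
    rw [genPotential_zero] at h1
    have h2 := (Complex.continuous_re.tendsto _).comp h1
    refine (h2.congr fun n ↦ ?_).trans (by rw [Complex.ofReal_re])
    simp only [Function.comp_apply, ← hpc, Complex.ofReal_re]
  obtain ⟨C, hC⟩ := exists_bound_of_isNormalized (x := x) (y := y) (z := z) (u := u)
    (η := fun n ↦ K * (|r| * (√(n : ℝ))⁻¹) ^ 3) (a := fun n m ↦ z n ^ m * gen (x n) (y n) m)
    (b := fun n m ↦ z n ^ m * gen (y n) (x n) m) (c := basePotential)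
    (fun n ↦ Real.exp_pos _) (fun n ↦ Real.exp_pos _) hz0 (fun n ↦ Real.exp_pos _)
    (lim (f := fun e ↦ Real.exp (α * e)) (by fun_prop) (by simp))
    (lim (f := fun e ↦ Real.exp (β * e)) (by fun_prop) (by simp))
    (lim (f := fun e ↦ tau * Real.exp ((-asympMean α β) * e +
      (-(asympVar α β / 2)) * e ^ 2)) (by fun_prop) (by simp))
    (lim (f := fun e ↦ Real.exp ((-((α - β) * tau ^ 2 / 2)) * e +
      (-((α ^ 2 - β ^ 2) * tau / 20)) * e ^ 2)) (by fun_prop) (by simp))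
    (fun n m ↦ mul_nonneg (pow_nonneg (hz0 n).le _)
      (gen_nonneg (Real.exp_pos _).le (Real.exp_pos _).le m))
    (fun n m ↦ mul_nonneg (pow_nonneg (hz0 n).le _)
      (gen_nonneg (Real.exp_pos _).le (Real.exp_pos _).le m))
    (fun n ↦ isNormalized_gen _ _ _)
    (by
      filter_upwards [hd] with n hn
      have := hn.1
      rw [hbound, hxc, hyc, hzc, huc] at this
      rw [← Real.norm_eq_abs, ← Complex.norm_real]
      simpa [defect₁] using this)
    (by
      filter_upwards [hd] with n hn
      have := hn.2
      rw [hbound, hxc, hyc, hzc, huc] at this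
      rw [← Real.norm_eq_abs, ← Complex.norm_real]
      simpa [defect₂] using this)
    (tendsto_mul_cube _ _) hpot
  refine ⟨C, ?_⟩
  filter_upwards [hC] with n hn m hm
  have := (hn m hm).1
  rw [hzc, Complex.norm_real, Real.norm_of_nonneg (hz0 n).le]
  exact this

theorem asympMean_comm (α β : ℝ) : asympMean α β = asympMean β α := by
  unfold asympMean; ring

theorem asympVar_comm (α β : ℝ) : asympVar α β = asympVar β α := by
  unfold asympVar; ring

theorem root_comm (α β : ℝ) : root α β = root β α := by
  ext ε
  rw [root, root, asympMean_comm, asympVar_comm]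

/-- By `norm_gen_le` the generating function is dominated by its value at `w.re`. Replacing `w` by
`w.re` in `root` costs a factor exp(O(1/n)), whose `m`-th power stays bounded. -/
theorem exists_bound_complex (α β : ℝ) (w : ℂ) : ∃ C, ∀ᶠ n : ℕ in atTop, ∀ m ≤ n + 10,
    ‖root α β (w / √(n : ℝ)) ^ m *
      gen (quadExp α (0 : ℝ) (w / √(n : ℝ))) (quadExp β (0 : ℝ) (w / √(n : ℝ))) m‖ ≤ C := by
  obtain ⟨C, hC⟩ := exists_bound_real α β w.re
  refine ⟨Real.exp (asympVar α β / 2 * (11 * w.im ^ 2)) * C, ?_⟩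
  filter_upwards [hC, eventually_gt_atTop 0] with n hn hn0 m hm
  have hn1 : (1 : ℝ) ≤ n := by exact_mod_cast hn0
  have hre : (w / (√(n : ℝ) : ℂ)).re = w.re / √(n : ℝ) := Complex.div_ofReal_re _ _
  have him : (w / (√(n : ℝ) : ℂ)).im = w.im / √(n : ℝ) := Complex.div_ofReal_im _ _
  have hroot : ‖root α β (w / √(n : ℝ))‖ = ‖root α β (w.re / √(n : ℝ) : ℝ)‖ *
      Real.exp (asympVar α β / 2 * (w.im / √(n : ℝ)) ^ 2) := by
    rw [root, root, norm_mul, norm_mul, norm_quadExp, norm_quadExp, hre, him, Complex.ofReal_re,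
      Complex.ofReal_im, neg_neg]
    simp [mul_assoc]
  have hpow : Real.exp (asympVar α β / 2 * (w.im / √(n : ℝ)) ^ 2) ^ m ≤
      Real.exp (asympVar α β / 2 * (11 * w.im ^ 2)) := by
    rw [← Real.exp_nat_mul, Real.exp_le_exp, div_pow, Real.sq_sqrt n.cast_nonneg]
    -- From `m ≤ n + 10` and `1 ≤ n`.
    have hm' : (m : ℝ) ≤ 11 * n := by
      have : (m : ℝ) ≤ n + 10 := by exact_mod_cast hm
      linarith
    have hv := asympVar_nonneg α β
    have : (m : ℝ) * (w.im ^ 2 / n) ≤ 11 * w.im ^ 2 := by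
      rw [mul_div_assoc', div_le_iff₀ (by linarith)]
      nlinarith [sq_nonneg w.im]
    calc (m : ℝ) * (asympVar α β / 2 * (w.im ^ 2 / n))
        = asympVar α β / 2 * (m * (w.im ^ 2 / n)) := by ring
      _ ≤ _ := mul_le_mul_of_nonneg_left this (by linarith)
  have hgen := norm_gen_le (quadExp α (0 : ℝ) (w / √(n : ℝ))) (quadExp β (0 : ℝ) (w / √(n : ℝ))) m
  rw [norm_quadExp, norm_quadExp, hre] at hgen
  simp only [zero_mul, neg_zero, add_zero, Real.exp_zero, mul_one] at hgen
  rw [norm_mul, norm_pow, hroot, mul_pow]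
  calc ‖root α β (w.re / √(n : ℝ) : ℝ)‖ ^ m *
        Real.exp (asympVar α β / 2 * (w.im / √(n : ℝ)) ^ 2) ^ m * _
      ≤ ‖root α β (w.re / √(n : ℝ) : ℝ)‖ ^ m * Real.exp (asympVar α β / 2 * (11 * w.im ^ 2)) *
        gen (Real.exp (α * (w.re / √(n : ℝ)))) (Real.exp (β * (w.re / √(n : ℝ)))) m := by
        gcongr
    _ = Real.exp (asympVar α β / 2 * (11 * w.im ^ 2)) * (‖root α β (w.re / √(n : ℝ) : ℝ)‖ ^ m *
        gen (Real.exp (α * (w.re / √(n : ℝ)))) (Real.exp (β * (w.re / √(n : ℝ)))) m) := by ring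
    _ ≤ _ := mul_le_mul_of_nonneg_left (hn m hm) (Real.exp_pos _).le

theorem tendsto_root_pow_mul_gen (α β : ℝ) (w : ℂ) :
    Tendsto (fun n : ℕ ↦ root α β (w / √(n : ℝ)) ^ n *
      gen (quadExp α (0 : ℝ) (w / √(n : ℝ))) (quadExp β (0 : ℝ) (w / √(n : ℝ))) n) atTop
      (𝓝 ((basePotential : ℂ) / (10 * tau ^ 2))) := by
  have he := tendsto_div_sqrt w
  obtain ⟨C₁, h₁⟩ := exists_bound_complex α β w
  obtain ⟨C₂, h₂⟩ := exists_bound_complex β α w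
  rw [root_comm β α] at h₂
  obtain ⟨K, hK⟩ := exists_defect_bound α β
  have hd := he.eventually hK
  simp only [norm_div_sqrt] at hd
  have lim : ∀ {f : ℂ → ℂ} {c : ℂ}, Continuous f → f 0 = c →
      Tendsto (fun n : ℕ ↦ f (w / √(n : ℝ))) atTop (𝓝 c) := fun hf hc ↦
    hc ▸ (hf.tendsto 0).comp he
  exact tendsto_diag_of_isNormalized
    (x := fun n ↦ quadExp α (0 : ℝ) (w / √(n : ℝ))) (y := fun n ↦ quadExp β (0 : ℝ) (w / √(n : ℝ)))
    (z := fun n ↦ root α β (w / √(n : ℝ))) (u := fun n ↦ weight α β (w / √(n : ℝ)))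
    (a := fun n m ↦ root α β (w / √(n : ℝ)) ^ m *
      gen (quadExp α (0 : ℝ) (w / √(n : ℝ))) (quadExp β (0 : ℝ) (w / √(n : ℝ))) m)
    (b := fun n m ↦ root α β (w / √(n : ℝ)) ^ m *
      gen (quadExp β (0 : ℝ) (w / √(n : ℝ))) (quadExp α (0 : ℝ) (w / √(n : ℝ))) m)
    (η := fun n : ℕ ↦ K * (‖w‖ * (√(n : ℝ))⁻¹) ^ 3) (C := max C₁ C₂)
    (lim (continuous_quadExp _ _) (quadExp_zero _ _))
    (lim (continuous_quadExp _ _) (quadExp_zero _ _)) (lim (continuous_root α β) (root_zero α β))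
    (h₁.mono fun n hn m hm ↦ (hn m hm).trans (le_max_left _ _))
    (h₂.mono fun n hn m hm ↦ (hn m hm).trans (le_max_right _ _))
    (fun n ↦ isNormalized_gen _ _ _) (lim (continuous_weight α β) (weight_zero α β))
    (hd.mono fun n hn ↦ hn.1) (hd.mono fun n hn ↦ hn.2) (tendsto_mul_cube _ _)
    (lim (continuous_genPotential α β) (genPotential_zero α β))

/-! ### The uniform measure and the limiting exponential transform. -/

theorem ae_mem_unif (n : ℕ) : ∀ᵐ N ∂unif n, N ∈ (Finset.Ioc (S n) (S (n + 1)) : Set ℤ) := by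
  have h : unif n (Finset.Ioc (S n) (S (n + 1)) : Set ℤ) = 1 := by
    rw [Finset.coe_Ioc]
    exact uniformOn_self (Set.finite_Ioc _ _) (Set.nonempty_Ioc.2 (S_lt_succ n))
  exact (prob_compl_eq_zero_iff (Finset.measurableSet _)).2 h

theorem restrict_unif (n : ℕ) :
    (unif n).restrict (Finset.Ioc (S n) (S (n + 1)) : Set ℤ) = unif n :=
  Measure.restrict_eq_self_of_ae_mem (ae_mem_unif n)

theorem integrable_unif {E : Type*} [NormedAddCommGroup E] (n : ℕ) (f : ℤ → E) :
    Integrable f (unif n) := by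
  have h : IntegrableOn f (Finset.Ioc (S n) (S (n + 1)) : Set ℤ) (unif n) := IntegrableOn.finset
  rwa [IntegrableOn, restrict_unif] at h

theorem memLp_unif (n : ℕ) (f : ℤ → ℝ) : MemLp f 2 (unif n) :=
  (memLp_two_iff_integrable_sq (integrable_unif n f).aestronglyMeasurable).2 (integrable_unif n _)

theorem integral_unif (n : ℕ) (f : ℤ → ℂ) :
    ∫ N, f N ∂unif n = (∑ N ∈ Finset.Ioc (S n) (S (n + 1)), f N) / gen 1 1 n := by
  have hgen : gen (1 : ℂ) 1 n = ((Finset.Ioc (S n) (S (n + 1))).card : ℂ) := by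
    simp [gen, monomial]
  rw [← restrict_unif, setIntegral_finset _ IntegrableOn.finset, Finset.sum_div]
  refine Finset.sum_congr rfl fun N hN ↦ ?_
  have h : (unif n).real {N} = ((Finset.Ioc (S n) (S (n + 1))).card : ℝ)⁻¹ := by
    have := uniformOn_apply_finset (s := Finset.Ioc (S n) (S (n + 1))) (t := {N})
    rw [Finset.inter_singleton_of_mem hN, Finset.coe_Ioc, Finset.coe_singleton] at this
    rw [Measure.real, unif, this]
    simp
  rw [h, hgen, Complex.real_smul, div_eq_inv_mul]
  push_cast
  rfl

/-- The rescaled deviation of `α` times the number of positive summands plus `β` times the number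
of negative summands from its asymptotic mean. -/
noncomputable def deviation (α β : ℝ) (n : ℕ) (N : ℤ) : ℝ :=
  (α * numPos N + β * numNeg N - asympMean α β * n) / √(n : ℝ)

/-- With ε = w/√n, the `n`-th power of `root` contains exactly the centring term and exp(-σ²w²/2),
so the Gaussian factor appears with no error term. -/
theorem integral_exp_deviation (α β : ℝ) (w : ℂ) {n : ℕ} (hn : 0 < n) :
    ∫ N, Complex.exp (w * deviation α β n N) ∂unif n =
      Complex.exp (asympVar α β / 2 * w ^ 2) * ((root α β (w / √(n : ℝ)) ^ n *
        gen (quadExp α (0 : ℝ) (w / √(n : ℝ))) (quadExp β (0 : ℝ) (w / √(n : ℝ))) n) /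
        (tau ^ n * gen 1 1 n)) := by
  have hs : (√(n : ℝ) : ℂ) ≠ 0 := by
    have : (0 : ℝ) < √(n : ℝ) := by positivity
    exact_mod_cast this.ne'
  have hsq : (n : ℂ) = (√(n : ℝ) : ℂ) ^ 2 := by
    exact_mod_cast (Real.sq_sqrt n.cast_nonneg).symm
  have hτ : (tau : ℂ) ≠ 0 := by exact_mod_cast tau_pos.ne'
  rw [integral_unif]
  generalize gen (1 : ℂ) 1 n = g
  rw [gen, Finset.mul_sum, Finset.sum_div, Finset.sum_div, Finset.mul_sum]
  refine Finset.sum_congr rfl fun N _ ↦ ?_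
  have key : Complex.exp (w * deviation α β n N) * tau ^ n =
      Complex.exp (asympVar α β / 2 * w ^ 2) * (root α β (w / √(n : ℝ)) ^ n *
        monomial (quadExp α (0 : ℝ) (w / √(n : ℝ))) (quadExp β (0 : ℝ) (w / √(n : ℝ))) N) := by
    rw [root, mul_pow, quadExp_pow, monomial, quadExp_pow, quadExp_pow]
    simp only [quadExp]
    rw [mul_assoc ((tau : ℂ) ^ n), ← Complex.exp_add, ← Complex.exp_add, mul_left_comm,
      ← Complex.exp_add, mul_comm]
    congr 2
    simp only [deviation, numPos, numNeg]
    push_cast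
    field_simp
    rw [hsq]
    ring
  rw [mul_div_assoc', ← key, mul_comm (Complex.exp _), mul_div_mul_left _ _ (pow_ne_zero n hτ)]

/-- Numerator and denominator in `integral_exp_deviation` have the same nonzero limit, independent
of direction and `w`; the denominator is the case α = β = w = 0. -/
theorem tendsto_integral_exp_deviation (α β : ℝ) (w : ℂ) :
    Tendsto (fun n ↦ ∫ N, Complex.exp (w * deviation α β n N) ∂unif n) atTop
      (𝓝 (Complex.exp (asympVar α β / 2 * w ^ 2))) := by
  have h1 := tendsto_root_pow_mul_gen α β w
  have h2 := tendsto_root_pow_mul_gen 0 0 0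
  have hne : (basePotential : ℂ) / (10 * tau ^ 2) ≠ 0 := by
    have := basePotential_pos
    have := tau_pos
    exact_mod_cast (show basePotential / (10 * tau ^ 2) ≠ 0 by positivity)
  have h3 := (h1.div h2 hne).const_mul (Complex.exp (asympVar α β / 2 * w ^ 2))
  rw [div_self hne, mul_one] at h3
  refine h3.congr' ?_
  filter_upwards [eventually_gt_atTop 0] with n hn
  rw [integral_exp_deviation α β w hn]
  simp [root_zero]

/-! ### Moment convergence from moment generating functions. -/

theorem abs_exp_sub_quadratic_le (x s : ℝ) (hs0 : 0 ≤ s) (hs : s ≤ 1) :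
    |Real.exp (s * x) - 1 - s * x - s ^ 2 * x ^ 2 / 2| ≤
      6 * s ^ 3 * (Real.exp (2 * x) + Real.exp (-(2 * x))) := by
  have h1 := Complex.norm_exp_sub_sum_le_norm_mul_exp ((s * x : ℝ) : ℂ) 3
  have e1 : Complex.exp ((s * x : ℝ) : ℂ) -
      ∑ m ∈ Finset.range 3, ((s * x : ℝ) : ℂ) ^ m / m.factorial =
      ((Real.exp (s * x) - 1 - s * x - s ^ 2 * x ^ 2 / 2 : ℝ) : ℂ) := by
    simp [Finset.sum_range_succ]
    ring
  rw [e1, Complex.norm_real, Complex.norm_real, Real.norm_eq_abs, Real.norm_eq_abs, abs_mul,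
    abs_of_nonneg hs0, mul_pow] at h1
  have h2 := Real.pow_div_factorial_le_exp |x| (abs_nonneg x) 3
  have h3 : Real.exp (s * |x|) ≤ Real.exp |x| :=
    Real.exp_le_exp.2 (mul_le_of_le_one_left (abs_nonneg x) hs)
  have h4 : Real.exp |x| * Real.exp |x| ≤ Real.exp (2 * x) + Real.exp (-(2 * x)) := by
    rw [← Real.exp_add]
    rcases abs_cases x with ⟨h, _⟩ | ⟨h, _⟩
    · rw [h, ← two_mul]
      linarith [Real.exp_pos (-(2 * x))]
    · rw [h, show -x + -x = -(2 * x) by ring]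
      linarith [Real.exp_pos (2 * x)]
  have h5 : |x| ^ 3 ≤ 6 * Real.exp |x| := by
    norm_num [Nat.factorial] at h2
    linarith
  refine h1.trans ?_
  calc s ^ 3 * |x| ^ 3 * Real.exp (s * |x|) ≤ s ^ 3 * (6 * Real.exp |x|) * Real.exp |x| := by gcongr
    _ = 6 * s ^ 3 * (Real.exp |x| * Real.exp |x|) := by ring
    _ ≤ _ := by gcongr

section Moments

variable {X : ℕ → ℤ → ℝ} {v : ℝ}

theorem abs_mgf_sub_le (n : ℕ) {s : ℝ} (hs0 : 0 ≤ s) (hs : s ≤ 1) :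
    |∫ N, Real.exp (s * X n N) ∂unif n - 1 - s * ∫ N, X n N ∂unif n -
      s ^ 2 * (∫ N, X n N ^ 2 ∂unif n) / 2| ≤
    6 * s ^ 3 * (∫ N, Real.exp (2 * X n N) ∂unif n + ∫ N, Real.exp (-2 * X n N) ∂unif n) := by
  have hI := fun f : ℤ → ℝ ↦ integrable_unif n f
  have e1 : ∫ N, Real.exp (s * X n N) ∂unif n - 1 - s * ∫ N, X n N ∂unif n -
      s ^ 2 * (∫ N, X n N ^ 2 ∂unif n) / 2 =
      ∫ N, (Real.exp (s * X n N) - 1 - s * X n N - s ^ 2 * X n N ^ 2 / 2) ∂unif n := by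
    rw [integral_sub (hI _) (hI _), integral_sub (hI _) (hI _), integral_sub (hI _) (hI _),
      integral_div, integral_const_mul, integral_const_mul]
    simp
  have e2 : 6 * s ^ 3 * (∫ N, Real.exp (2 * X n N) ∂unif n + ∫ N, Real.exp (-2 * X n N) ∂unif n) =
      ∫ N, 6 * s ^ 3 * (Real.exp (2 * X n N) + Real.exp (-(2 * X n N))) ∂unif n := by
    rw [integral_const_mul, integral_add (hI _) (hI _)]
    simp only [neg_mul]
  rw [e1, e2]
  refine (abs_integral_le_integral_abs).trans (integral_mono (hI _) (hI _) fun N ↦ ?_)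
  exact abs_exp_sub_quadratic_le _ _ hs0 hs

variable (h : ∀ s : ℝ, Tendsto (fun n ↦ ∫ N, Real.exp (s * X n N) ∂unif n) atTop
  (𝓝 (Real.exp (v / 2 * s ^ 2))))

include h

theorem tendsto_tail : Tendsto (fun n ↦ ∫ N, Real.exp (2 * X n N) ∂unif n +
    ∫ N, Real.exp (-2 * X n N) ∂unif n) atTop (𝓝 (2 * Real.exp (2 * v))) := by
  convert! (h 2).add (h (-2)) using 2
  ring_nf

omit h in
theorem abs_mgf_neg_sub_le (n : ℕ) {s : ℝ} (hs0 : 0 ≤ s) (hs : s ≤ 1) :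
    |∫ N, Real.exp (-s * X n N) ∂unif n - 1 + s * ∫ N, X n N ∂unif n -
      s ^ 2 * (∫ N, X n N ^ 2 ∂unif n) / 2| ≤
    6 * s ^ 3 * (∫ N, Real.exp (2 * X n N) ∂unif n + ∫ N, Real.exp (-2 * X n N) ∂unif n) := by
  have := abs_mgf_sub_le (X := fun n N ↦ -X n N) n hs0 hs
  simp only [mul_neg, neg_sq, integral_neg, neg_mul, neg_neg, sub_neg_eq_add] at this
  rw [add_comm (∫ N, Real.exp (-(2 * X n N)) ∂unif n)] at this
  simpa only [neg_mul] using this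

/-- The odd part M(s) - M(-s) is 2s times the mean up to O(s³), uniformly in large `n`, and tends to
0 for fixed `s` since the limit is even. Hence the limsup of the absolute mean is O(s²), with `s`
arbitrary. -/
theorem tendsto_integral_of_mgf : Tendsto (fun n ↦ ∫ N, X n N ∂unif n) atTop (𝓝 0) := by
  set T := 2 * Real.exp (2 * v) with hT
  have hT0 : 0 < T := by positivity
  rw [tendsto_zero_iff_abs_tendsto_zero]
  refine tendsto_order.2 ⟨fun a ha ↦ Eventually.of_forall fun n ↦ ha.trans_le (abs_nonneg _),
    fun δ hδ ↦ ?_⟩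
  have hs : ∀ᶠ s : ℝ in 𝓝[>] 0, 6 * s ^ 2 * T < δ := by
    have hc : Continuous fun s : ℝ ↦ 6 * s ^ 2 * T := by fun_prop
    have := hc.tendsto 0
    simp only [ne_eq, OfNat.ofNat_ne_zero, not_false_eq_true, zero_pow, mul_zero, zero_mul] at this
    exact (this.mono_left nhdsWithin_le_nhds).eventually_lt_const hδ
  obtain ⟨s, ⟨hsδ, hs1⟩, hs0 : 0 < s⟩ := ((hs.and ((eventually_le_nhds
    (show (0 : ℝ) < 1 by norm_num)).filter_mono nhdsWithin_le_nhds)).and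
      self_mem_nhdsWithin).exists
  have hlim : Tendsto (fun n ↦ |∫ N, Real.exp (s * X n N) ∂unif n -
      ∫ N, Real.exp (-s * X n N) ∂unif n| / (2 * s) + 6 * s ^ 2 *
      (∫ N, Real.exp (2 * X n N) ∂unif n + ∫ N, Real.exp (-2 * X n N) ∂unif n)) atTop
      (𝓝 (6 * s ^ 2 * T)) := by
    have := ((((h s).sub (h (-s))).abs).div_const (2 * s)).add
      ((tendsto_tail h).const_mul (6 * s ^ 2))
    simpa using this
  filter_upwards [hlim.eventually_lt_const hsδ] with n hn
  refine lt_of_le_of_lt ?_ hn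
  have h1 := abs_mgf_sub_le (X := X) n hs0.le hs1
  have h2 := abs_mgf_neg_sub_le (X := X) n hs0.le hs1
  set A := ∫ N, Real.exp (s * X n N) ∂unif n
  set B := ∫ N, Real.exp (-s * X n N) ∂unif n
  set U := ∫ N, Real.exp (2 * X n N) ∂unif n + ∫ N, Real.exp (-2 * X n N) ∂unif n
  set m := ∫ N, X n N ∂unif n
  set q := ∫ N, X n N ^ 2 ∂unif n
  have e : m = (A - B) / (2 * s) - ((A - 1 - s * m - s ^ 2 * q / 2) -
      (B - 1 + s * m - s ^ 2 * q / 2)) / (2 * s) := by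
    field_simp
    ring
  calc |m| ≤ |(A - B) / (2 * s)| + |((A - 1 - s * m - s ^ 2 * q / 2) -
      (B - 1 + s * m - s ^ 2 * q / 2)) / (2 * s)| := by
        conv_lhs => rw [e]
        exact abs_sub _ _
    _ ≤ |A - B| / (2 * s) + (6 * s ^ 3 * U + 6 * s ^ 3 * U) / (2 * s) := by
        rw [abs_div, abs_div, abs_of_pos (show 0 < 2 * s by linarith)]
        gcongr
        exact (abs_sub _ _).trans (add_le_add h1 h2)
    _ = _ := by
        field_simp
        ring

/-- The even part M(s) + M(-s) - 2 is s² times the second moment up to O(s³); dividing by s² leaves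
an error O(s), and the limiting exponential contributes `v` up to O(s²). -/
theorem tendsto_integral_sq_of_mgf : Tendsto (fun n ↦ ∫ N, X n N ^ 2 ∂unif n) atTop (𝓝 v) := by
  set T := 2 * Real.exp (2 * v) with hT
  have hT0 : 0 < T := by positivity
  rw [tendsto_iff_dist_tendsto_zero]
  refine tendsto_order.2 ⟨fun a ha ↦ Eventually.of_forall fun n ↦ ha.trans_le dist_nonneg,
    fun δ hδ ↦ ?_⟩
  have hs : ∀ᶠ s : ℝ in 𝓝[>] 0, v ^ 2 * s ^ 2 / 2 + 12 * s * T < δ := by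
    have hc : Continuous fun s : ℝ ↦ v ^ 2 * s ^ 2 / 2 + 12 * s * T := by fun_prop
    have := hc.tendsto 0
    simp only [ne_eq, OfNat.ofNat_ne_zero, not_false_eq_true, zero_pow, mul_zero, zero_mul,
      zero_div, add_zero] at this
    exact (this.mono_left nhdsWithin_le_nhds).eventually_lt_const hδ
  have hv : ∀ᶠ s : ℝ in 𝓝[>] 0, |v / 2 * s ^ 2| ≤ 1 := by
    have hc : Continuous fun s : ℝ ↦ |v / 2 * s ^ 2| := by fun_prop
    have := hc.tendsto 0
    simp only [ne_eq, OfNat.ofNat_ne_zero, not_false_eq_true, zero_pow, mul_zero, abs_zero] at this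
    exact (this.mono_left nhdsWithin_le_nhds).eventually_le_const one_pos
  obtain ⟨s, ⟨⟨hsδ, hsv⟩, hs1⟩, hs0 : 0 < s⟩ := (((hs.and hv).and ((eventually_le_nhds
    (show (0 : ℝ) < 1 by norm_num)).filter_mono nhdsWithin_le_nhds)).and
      self_mem_nhdsWithin).exists
  have hlim : Tendsto (fun n ↦ |(∫ N, Real.exp (s * X n N) ∂unif n +
      ∫ N, Real.exp (-s * X n N) ∂unif n - 2) / s ^ 2 - v| + 12 * s *
      (∫ N, Real.exp (2 * X n N) ∂unif n + ∫ N, Real.exp (-2 * X n N) ∂unif n)) atTop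
      (𝓝 (|(Real.exp (v / 2 * s ^ 2) + Real.exp (v / 2 * s ^ 2) - 2) / s ^ 2 - v| +
        12 * s * T)) := by
    have := ((((((h s).add (h (-s))).sub_const 2).div_const (s ^ 2)).sub_const v).abs).add
      ((tendsto_tail h).const_mul (12 * s))
    simpa only [neg_sq] using this
  have hb : |(Real.exp (v / 2 * s ^ 2) + Real.exp (v / 2 * s ^ 2) - 2) / s ^ 2 - v| ≤
      v ^ 2 * s ^ 2 / 2 := by
    have e : (Real.exp (v / 2 * s ^ 2) + Real.exp (v / 2 * s ^ 2) - 2) / s ^ 2 - v =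
        2 / s ^ 2 * (Real.exp (v / 2 * s ^ 2) - 1 - v / 2 * s ^ 2) := by
      field_simp
      ring
    rw [e, abs_mul, abs_of_pos (by positivity)]
    calc 2 / s ^ 2 * |Real.exp (v / 2 * s ^ 2) - 1 - v / 2 * s ^ 2|
        ≤ 2 / s ^ 2 * (v / 2 * s ^ 2) ^ 2 := by
          gcongr
          exact Real.abs_exp_sub_one_sub_id_le hsv
      _ = _ := by field_simp
  filter_upwards [hlim.eventually_lt_const
    ((add_le_add_left hb (12 * s * T)).trans_lt hsδ)] with n hn
  refine lt_of_le_of_lt ?_ hn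
  have h1 := abs_mgf_sub_le (X := X) n hs0.le hs1
  have h2 := abs_mgf_neg_sub_le (X := X) n hs0.le hs1
  rw [Real.dist_eq]
  set A := ∫ N, Real.exp (s * X n N) ∂unif n
  set B := ∫ N, Real.exp (-s * X n N) ∂unif n
  set U := ∫ N, Real.exp (2 * X n N) ∂unif n + ∫ N, Real.exp (-2 * X n N) ∂unif n
  set m := ∫ N, X n N ∂unif n
  set q := ∫ N, X n N ^ 2 ∂unif n
  have e : q - v = ((A + B - 2) / s ^ 2 - v) - ((A - 1 - s * m - s ^ 2 * q / 2) +
      (B - 1 + s * m - s ^ 2 * q / 2)) / s ^ 2 := by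
    field_simp
    ring
  calc |q - v| ≤ |(A + B - 2) / s ^ 2 - v| + |((A - 1 - s * m - s ^ 2 * q / 2) +
      (B - 1 + s * m - s ^ 2 * q / 2)) / s ^ 2| := by
        rw [e]
        exact abs_sub _ _
    _ ≤ |(A + B - 2) / s ^ 2 - v| + (6 * s ^ 3 * U + 6 * s ^ 3 * U) / s ^ 2 := by
        rw [abs_div _ (s ^ 2), abs_of_pos (show 0 < s ^ 2 by positivity)]
        gcongr
        exact (abs_add_le _ _).trans (add_le_add h1 h2)
    _ = _ := by
        field_simp
        ring

end Moments

/-! ### Variances, covariance and correlation. -/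

theorem tendsto_mgf_deviation (α β s : ℝ) :
    Tendsto (fun n ↦ ∫ N, Real.exp (s * deviation α β n N) ∂unif n) atTop
      (𝓝 (Real.exp (asympVar α β / 2 * s ^ 2))) := by
  have h := (Complex.continuous_re.tendsto _).comp (tendsto_integral_exp_deviation α β s)
  have e : Complex.exp (asympVar α β / 2 * (s : ℂ) ^ 2) =
      ((Real.exp (asympVar α β / 2 * s ^ 2) : ℝ) : ℂ) := by push_cast; rfl
  rw [e, Complex.ofReal_re] at h
  refine h.congr fun n ↦ ?_
  have e2 : ∫ N, Complex.exp (s * deviation α β n N) ∂unif n =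
      ((∫ N, Real.exp (s * deviation α β n N) ∂unif n : ℝ) : ℂ) := by
    rw [← integral_complex_ofReal]
    push_cast
    rfl
  rw [Function.comp_apply, e2, Complex.ofReal_re]

theorem tendsto_integral_deviation (α β : ℝ) :
    Tendsto (fun n ↦ ∫ N, deviation α β n N ∂unif n) atTop (𝓝 0) :=
  tendsto_integral_of_mgf (tendsto_mgf_deviation α β)

theorem tendsto_integral_deviation_sq (α β : ℝ) :
    Tendsto (fun n ↦ ∫ N, deviation α β n N ^ 2 ∂unif n) atTop (𝓝 (asympVar α β)) :=
  tendsto_integral_sq_of_mgf (tendsto_mgf_deviation α β)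

theorem variance_affine (n : ℕ) (Y : ℤ → ℝ) (c d : ℝ) :
    variance (fun N ↦ c * Y N + d) (unif n) = c ^ 2 * variance Y (unif n) := by
  rw [variance_add_const (integrable_unif n _).aestronglyMeasurable, variance_const_mul]

theorem standardize_affine (n : ℕ) (Y : ℤ → ℝ) {c : ℝ} (hc : 0 < c) (d : ℝ) :
    standardize (fun N ↦ c * Y N + d) (unif n) = standardize Y (unif n) := by
  ext N
  have hI := fun f : ℤ → ℝ ↦ integrable_unif n f
  rw [standardize, standardize, variance_affine, integral_add (hI _) (hI _), integral_const_mul,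
    Real.sqrt_mul (sq_nonneg c), Real.sqrt_sq hc.le]
  simp only [integral_const, probReal_univ, smul_eq_mul, one_mul]
  rw [show c * Y N + d - (c * ∫ N, Y N ∂unif n + d) = c * (Y N - ∫ N, Y N ∂unif n) by ring,
    mul_div_mul_left _ _ hc.ne']

theorem correlation_affine (n : ℕ) (Y Z : ℤ → ℝ) {c : ℝ} (hc : 0 < c) (d e : ℝ) :
    correlation (fun N ↦ c * Y N + d) (fun N ↦ c * Z N + e) (unif n) =
      correlation Y Z (unif n) := by
  have hI := fun f : ℤ → ℝ ↦ integrable_unif n f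
  rw [correlation, correlation, variance_affine, variance_affine,
    covariance_add_const_left (hI _), covariance_add_const_right (hI _),
    covariance_const_mul_left, covariance_const_mul_right, Real.sqrt_mul (sq_nonneg c),
    Real.sqrt_mul (sq_nonneg c), Real.sqrt_sq hc.le]
  rw [show c * √(variance Y (unif n)) * (c * √(variance Z (unif n))) =
    c * (c * (√(variance Y (unif n)) * √(variance Z (unif n)))) by ring,
    mul_div_mul_left _ _ hc.ne', mul_div_mul_left _ _ hc.ne']

theorem numPos_eq {n : ℕ} (hn : 0 < n) :
    numPos = fun N ↦ √(n : ℝ) * deviation 1 0 n N + asympMean 1 0 * n := by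
  have hs : √(n : ℝ) ≠ 0 := by positivity
  ext N
  rw [deviation, mul_div_cancel₀ _ hs]
  ring

theorem numNeg_eq {n : ℕ} (hn : 0 < n) :
    numNeg = fun N ↦ √(n : ℝ) * deviation 0 1 n N + asympMean 0 1 * n := by
  have hs : √(n : ℝ) ≠ 0 := by positivity
  ext N
  rw [deviation, mul_div_cancel₀ _ hs]
  ring

theorem standardize_numPos {n : ℕ} (hn : 0 < n) :
    standardize numPos (unif n) = standardize (deviation 1 0 n) (unif n) := by
  rw [numPos_eq hn]
  exact standardize_affine n _ (by positivity) _

theorem standardize_numNeg {n : ℕ} (hn : 0 < n) :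
    standardize numNeg (unif n) = standardize (deviation 0 1 n) (unif n) := by
  rw [numNeg_eq hn]
  exact standardize_affine n _ (by positivity) _

theorem deviation_eq (α β : ℝ) (n : ℕ) (N : ℤ) :
    deviation α β n N = α * deviation 1 0 n N + β * deviation 0 1 n N := by
  simp only [deviation, asympMean]
  ring

theorem asympVar_one_zero_pos : 0 < asympVar 1 0 := by
  have := tau_pos
  unfold asympVar
  norm_num
  positivity

/-- With φ = 1 + τ, ρ is the ratio of the mixed coefficient (2τ + 1)/250 - τ/20 to the common
diagonal coefficient (2τ + 1)/250 + τ/20 of the quadratic form `asympVar`. -/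
theorem asympVar_eq {ρ : ℝ}
    (hρ : ρ = -(21 - 2 * Real.goldenRatio) / (29 + 2 * Real.goldenRatio)) (α β : ℝ) :
    asympVar α β = asympVar 1 0 * (α ^ 2 + 2 * ρ * (α * β) + β ^ 2) := by
  have ht := tau_pos
  have hφ : Real.goldenRatio = 1 + tau := by
    have h1 : tau = -Real.goldenConj := Real.inv_goldenRatio
    linarith [Real.goldenRatio_add_goldenConj]
  have hden : 31 + 2 * tau ≠ 0 := by positivity
  have key : asympVar 1 0 * ρ = (2 * tau + 1) / 250 - tau / 20 := by
    rw [hρ, hφ, show 29 + 2 * (1 + tau) = 31 + 2 * tau by ring, mul_div_assoc', div_eq_iff hden]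
    unfold asympVar
    linear_combination (1 / 5 : ℝ) * tau_sq
  have : asympVar 1 0 = (2 * tau + 1) / 250 + tau / 20 := by unfold asympVar; ring
  calc asympVar α β = ((2 * tau + 1) / 250 + tau / 20) * (α ^ 2 + β ^ 2) +
        2 * ((2 * tau + 1) / 250 - tau / 20) * (α * β) := by unfold asympVar; ring
    _ = _ := by rw [← key, ← this]; ring

theorem variance_deviation (α β : ℝ) (n : ℕ) : variance (deviation α β n) (unif n) =
    ∫ N, deviation α β n N ^ 2 ∂unif n - (∫ N, deviation α β n N ∂unif n) ^ 2 :=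
  variance_eq_sub (memLp_unif n _)

theorem tendsto_variance_deviation (α β : ℝ) :
    Tendsto (fun n ↦ variance (deviation α β n) (unif n)) atTop (𝓝 (asympVar α β)) := by
  simp only [variance_deviation]
  simpa using (tendsto_integral_deviation_sq α β).sub ((tendsto_integral_deviation α β).pow 2)

theorem asympVar_zero_one : asympVar 0 1 = asympVar 1 0 := asympVar_comm 0 1

/-- Polarization: the variance in direction (1, 1) supplies the covariance. -/
theorem tendsto_covariance_deviation :
    Tendsto (fun n ↦ covariance (deviation 1 0 n) (deviation 0 1 n) (unif n)) atTop
      (𝓝 ((asympVar 1 1 - asympVar 1 0 - asympVar 0 1) / 2)) := by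
  refine (((tendsto_variance_deviation 1 1).sub (tendsto_variance_deviation 1 0)).sub
    (tendsto_variance_deviation 0 1)).div_const 2 |>.congr fun n ↦ ?_
  have h : deviation 1 1 n = deviation 1 0 n + deviation 0 1 n := by
    ext N
    rw [deviation_eq]
    simp
  rw [h, variance_add (memLp_unif n _) (memLp_unif n _)]
  ring

theorem tendsto_correlation {ρ : ℝ}
    (hρ : ρ = -(21 - 2 * Real.goldenRatio) / (29 + 2 * Real.goldenRatio)) :
    Tendsto (fun n ↦ correlation numPos numNeg (unif n)) atTop (𝓝 ρ) := by
  have hv := asympVar_one_zero_pos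
  have h := tendsto_covariance_deviation.div
    (((tendsto_variance_deviation 1 0).sqrt).mul ((tendsto_variance_deviation 0 1).sqrt))
    (by rw [asympVar_zero_one]; positivity)
  have e : (asympVar 1 1 - asympVar 1 0 - asympVar 0 1) / 2 /
      (√(asympVar 1 0) * √(asympVar 0 1)) = ρ := by
    rw [asympVar_zero_one, Real.mul_self_sqrt hv.le, asympVar_eq hρ 1 1]
    field_simp
    ring
  rw [e] at h
  refine h.congr' ?_
  filter_upwards [eventually_gt_atTop 0] with n hn
  rw [numPos_eq hn, numNeg_eq hn, correlation_affine n _ _ (by positivity)]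
  rfl

/-! ### From asymptotic to exact standardization, and characteristic functions. -/

theorem tendsto_integral_abs_standardize_sub {Y : ℕ → ℤ → ℝ} {v : ℝ} (hv : 0 < v)
    (h1 : Tendsto (fun n ↦ ∫ N, Y n N ∂unif n) atTop (𝓝 0))
    (h2 : Tendsto (fun n ↦ ∫ N, Y n N ^ 2 ∂unif n) atTop (𝓝 v)) :
    Tendsto (fun n ↦ ∫ N, |standardize (Y n) (unif n) N - Y n N / √v| ∂unif n) atTop (𝓝 0) := by
  have hvar : Tendsto (fun n ↦ variance (Y n) (unif n)) atTop (𝓝 v) := by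
    have : ∀ n, variance (Y n) (unif n) = ∫ N, Y n N ^ 2 ∂unif n - (∫ N, Y n N ∂unif n) ^ 2 :=
      fun n ↦ variance_eq_sub (memLp_unif n _)
    simp only [this]
    simpa using h2.sub (h1.pow 2)
  have hσ : Tendsto (fun n ↦ (√(variance (Y n) (unif n)))⁻¹) atTop (𝓝 (√v)⁻¹) :=
    hvar.sqrt.inv₀ (by positivity)
  have hlim : Tendsto (fun n ↦ |(√(variance (Y n) (unif n)))⁻¹ - (√v)⁻¹| *
      (1 + ∫ N, Y n N ^ 2 ∂unif n) + |(√(variance (Y n) (unif n)))⁻¹| * |∫ N, Y n N ∂unif n|)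
      atTop (𝓝 0) := by
    have := (((hσ.sub_const (√v)⁻¹).abs).mul (h2.const_add 1)).add (hσ.abs.mul h1.abs)
    simpa using this
  refine squeeze_zero (fun n ↦ integral_nonneg fun N ↦ abs_nonneg _) (fun n ↦ ?_) hlim
  have hI := fun f : ℤ → ℝ ↦ integrable_unif n f
  set m := ∫ N, Y n N ∂unif n
  set i := (√(variance (Y n) (unif n)))⁻¹
  have e : |i - (√v)⁻¹| * (1 + ∫ N, Y n N ^ 2 ∂unif n) + |i| * |m| =
      ∫ N, (|i - (√v)⁻¹| * (1 + Y n N ^ 2) + |i| * |m|) ∂unif n := by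
    rw [integral_add (hI _) (hI _), integral_const_mul, integral_add (hI _) (hI _)]
    simp
  rw [e]
  refine integral_mono (hI _) (hI _) fun N ↦ ?_
  have e2 : standardize (Y n) (unif n) N - Y n N / √v = (i - (√v)⁻¹) * Y n N - i * m := by
    simp only [standardize, div_eq_mul_inv, i, m]
    ring
  have e3 : |Y n N| ≤ 1 + Y n N ^ 2 := by
    rw [← sq_abs]
    nlinarith [sq_nonneg (|Y n N| - 1), abs_nonneg (Y n N)]
  simp only [e2]
  refine (abs_sub _ _).trans ?_
  rw [abs_mul, abs_mul]
  gcongr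

theorem norm_exp_mul_I_sub_le (a b : ℝ) :
    ‖Complex.exp (a * Complex.I) - Complex.exp (b * Complex.I)‖ ≤ |a - b| := by
  have e : Complex.exp (a * Complex.I) - Complex.exp (b * Complex.I) =
      Complex.exp (b * Complex.I) * (Complex.exp (Complex.I * (a - b : ℝ)) - 1) := by
    rw [mul_sub, ← Complex.exp_add, mul_one]
    push_cast
    ring_nf
  rw [e, norm_mul, Complex.norm_exp_ofReal_mul_I, one_mul]
  exact Real.norm_exp_I_mul_ofReal_sub_one_le

/-- Exact standardization is L¹-close to division of the deviation by √v, and t ↦ exp(it) is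
1-Lipschitz, so the limit can be computed from `tendsto_integral_exp_deviation` at w = i. -/
theorem tendsto_charFun_standardize (a b : ℝ) :
    Tendsto (fun n ↦ ∫ N, Complex.exp ((a * standardize numPos (unif n) N +
      b * standardize numNeg (unif n) N : ℝ) * Complex.I) ∂unif n) atTop
      (𝓝 (Complex.exp (-(asympVar a b / asympVar 1 0 : ℝ) / 2))) := by
  set v := asympVar 1 0 with hv
  have hv0 : 0 < v := asympVar_one_zero_pos
  have h1 := tendsto_integral_abs_standardize_sub hv0 (tendsto_integral_deviation 1 0)
    (tendsto_integral_deviation_sq 1 0)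
  have h2 := tendsto_integral_abs_standardize_sub hv0 (tendsto_integral_deviation 0 1)
    (by rw [hv, ← asympVar_zero_one]; exact tendsto_integral_deviation_sq 0 1)
  have hmain := tendsto_integral_exp_deviation (a / √v) (b / √v) Complex.I
  have elim : asympVar (a / √v) (b / √v) = asympVar a b / v := by
    have : asympVar (a / √v) (b / √v) = asympVar a b / √v ^ 2 := by
      unfold asympVar
      field_simp
    rw [this, Real.sq_sqrt hv0.le]
  rw [elim, Complex.I_sq] at hmain
  have hdiff : Tendsto (fun n ↦ ∫ N, Complex.exp ((a * standardize numPos (unif n) N +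
      b * standardize numNeg (unif n) N : ℝ) * Complex.I) ∂unif n -
      ∫ N, Complex.exp (Complex.I * deviation (a / √v) (b / √v) n N) ∂unif n) atTop (𝓝 0) := by
    refine squeeze_zero_norm' ?_
      (by simpa using (h1.const_mul |a|).add (h2.const_mul |b|))
    filter_upwards [eventually_gt_atTop 0] with n hn
    have hI := fun f : ℤ → ℝ ↦ integrable_unif n f
    rw [standardize_numPos hn, standardize_numNeg hn, ← integral_sub (integrable_unif n _)
      (integrable_unif n _), ← integral_const_mul, ← integral_const_mul,
      ← integral_add (hI _) (hI _)]
    refine (norm_integral_le_integral_norm _).trans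
      (integral_mono (integrable_unif n _) (hI _) fun N ↦ ?_)
    simp only
    rw [mul_comm Complex.I]
    refine (norm_exp_mul_I_sub_le _ _).trans ?_
    rw [deviation_eq, ← abs_mul, ← abs_mul]
    refine le_trans (le_of_eq ?_) (abs_add_le _ _)
    congr 1
    ring
  have := hdiff.add hmain
  simp only [sub_add_cancel, zero_add] at this
  convert! this using 2
  congr 1
  push_cast
  ring

theorem posSemidef_corr {ρ : ℝ} (h1 : -1 ≤ ρ) (h2 : ρ ≤ 1) :
    (!![1, ρ; ρ, 1] : Matrix (Fin 2) (Fin 2) ℝ).PosSemidef := by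
  refine Matrix.PosSemidef.of_dotProduct_mulVec_nonneg ?_ fun x ↦ ?_
  · ext i j
    fin_cases i <;> fin_cases j <;> simp
  · simp only [star_trivial, Matrix.mulVec, dotProduct, Fin.sum_univ_two, Matrix.of_apply,
      Matrix.cons_val_zero, Matrix.cons_val_one, Matrix.cons_val']
    -- The form is half of (1 - ρ)(x₀ - x₁)² + (1 + ρ)(x₀ + x₁)².
    nlinarith [mul_nonneg (sub_nonneg.2 h2) (sq_nonneg (x 0 - x 1)),
      mul_nonneg (show 0 ≤ 1 + ρ by linarith) (sq_nonneg (x 0 + x 1))]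

end FarDifference

/-! ### The joint limit law. -/

theorem mainTheorem4 (ρ : ℝ)
    (hρ : ρ = -(21 - 2 * Real.goldenRatio) / (29 + 2 * Real.goldenRatio)) :
    -- every integer has exactly one far-difference representation
    (∀ N : ℤ, ∃! R : FarDifference.SignedRep, FarDifference.IsFarDifferenceRepOf R N) ∧
    -- the integers in `(S n, S (n + 1)]` are those whose term of largest index is `+F (n + 1)`
    (∀ (n : ℕ) (N : ℤ), N ∈ Set.Ioc (FarDifference.S n) (FarDifference.S (n + 1)) ↔
      n + 1 ∈ (FarDifference.farDifferenceRep N).pos ∧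
      (∀ i ∈ (FarDifference.farDifferenceRep N).pos, i ≤ n + 1) ∧
      (∀ j ∈ (FarDifference.farDifferenceRep N).neg, j ≤ n + 1)) ∧
    -- joint convergence in distribution to a bivariate normal with correlation `ρ`
    TendstoInDistribution
      (fun (n : ℕ) (N : ℤ) ↦
        !₂[FarDifference.standardize FarDifference.numPos (FarDifference.unif n) N,
           FarDifference.standardize FarDifference.numNeg (FarDifference.unif n) N])
      atTop
      (id : EuclideanSpace ℝ (Fin 2) → EuclideanSpace ℝ (Fin 2))
      FarDifference.unif
      (multivariateGaussian 0 !![1, ρ; ρ, 1]) ∧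
    -- the correlation coefficients converge to `ρ`, which is negative
    Tendsto
      (fun n : ℕ ↦ FarDifference.correlation FarDifference.numPos FarDifference.numNeg
        (FarDifference.unif n))
      atTop (𝓝 ρ) ∧
    ρ < 0 ∧ |ρ - (-0.551058)| < 0.0000005 := by
  have hnum : ρ < 0 ∧ |ρ - (-0.551058)| < 0.0000005 := by
    have h1 : (1.6180339 : ℝ) < Real.goldenRatio := by
      nlinarith [Real.goldenRatio_sq, Real.goldenRatio_pos]
    have h2 : Real.goldenRatio < 1.6180340 := by
      nlinarith [Real.goldenRatio_sq, Real.goldenRatio_pos]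
    have hpos : 0 < 29 + 2 * Real.goldenRatio := by linarith
    have h3 : ρ < -0.5510575 := by rw [hρ, div_lt_iff₀ hpos]; linarith
    have h4 : -0.5510585 < ρ := by rw [hρ, lt_div_iff₀ hpos]; linarith
    refine ⟨by linarith, abs_lt.2 ⟨by linarith, by linarith⟩⟩
  refine ⟨FarDifference.existsUnique_rep, FarDifference.mem_Ioc_iff, ⟨?_, aemeasurable_id, ?_⟩,
    FarDifference.tendsto_correlation hρ, hnum⟩
  · exact fun n ↦ (measurable_of_countable _).aemeasurable
  -- Lévy's continuity theorem; by `asympVar_eq` the limit exponent is minus half the quadratic form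
  -- of the covariance matrix at `t`.
  · refine ProbabilityMeasure.tendsto_of_tendsto_charFun fun t ↦ ?_
    have hb := abs_lt.1 hnum.2
    have hS := FarDifference.posSemidef_corr (ρ := ρ) (by linarith) (by linarith [hnum.1])
    have h := FarDifference.tendsto_charFun_standardize (t 0) (t 1)
    simp only [ProbabilityMeasure.coe_mk, Measure.map_id]
    rw [charFun_multivariateGaussian hS]
    convert! h using 2 with n
    · rw [charFun_apply, integral_map (measurable_of_countable _).aemeasurable (by fun_prop)]
      refine integral_congr_ae (Eventually.of_forall fun N ↦ ?_)
      simp [PiLp.inner_apply, Fin.sum_univ_two]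
    · congr 1
      rw [FarDifference.asympVar_eq hρ (t 0) (t 1),
        mul_div_cancel_left₀ _ FarDifference.asympVar_one_zero_pos.ne']
      simp [Matrix.mulVec, dotProduct, Fin.sum_univ_two]
      ring
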